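/- **Notation.** Let $\mathbb Z_4=\{0,1,2,3\}$ and $\mathbb F_2=\{0,1\}\subset\mathbb Z_4$. For $x\in\mathbb Z_4$ let $\omega_1(x),\omega_2(x)\in\{0,1\}$ be its first (least significant) and second binary digits, applied entrywise to matrices. For a vector $v$ let $D(v)$ be the diagonal matrix with diagonal $v$; for a square matrix $A$ let $D(A)$ be its diagonal part. For $A\in\mathbb Z_4^{n\times n}$ put $\Omega_{1,2}(A)=\omega_1(A)+2\,\omega_2(D(A))$. Let $\mathbb J_n=\{A\in\mathbb Z_4^{n\times n}: A=A^T,\ \Omega_{1,2}(A)=A\}$. Let $\mathbb W_n\subseteq\mathbb J_n$ be the set of those $A$ for which $\omega_1(A)=LDL^T$ over $\mathbb F_2$ for some unit lower-triangular $L$ and some block-diagonal $D$ with diagonal blocks $[0]$, $[1]$ or $\begin{bmatrix}0&1\\1&0\end{bmatrix}$, where $L_{i+1,i}=0$ whenever rows $i,i+1$ of $D$ form a $2\times2$ block. **The process $\Gamma_k$.** Let $0\le k\le n$. $\Gamma_k(A)$ is defined for those $A\in\mathbb W_n$ whose leading $k\times k$ block lies in $\mathbb W_k$ and has rank $k$ over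 $\mathbb F_2$ after reduction by $\omega_1$. It is the final matrix $B$ of the following procedure. Start with $B=A$ and $i=1$. While $i\le k$: let $T=\{i\}$ if $\omega_1(b_{ii})=1$, and $T=\{i,i+1\}$ otherwise. Writing $B=\begin{bmatrix}B_{11}&B_{12}\\B_{21}&B_{22}\end{bmatrix}$ with the indices in $T$ placed first, replace $B$ by $$\Omega_{1,2}\left(\begin{bmatrix}B_{11}&\omega_1(B_{11})B_{12}\\ B_{21}\,\omega_1(B_{11})&B_{22}-B_{21}\,\omega_1(B_{11})B_{12}\end{bmatrix}\right)$$ (with the indices put back in their original order). Then replace $b_{jj}$ by $\omega_1(b_{jj})$ for $j\in T$, and increase $i$ by $|T|$. **Graph states.** For a simple graph $G$ on $\{1,\dots,n\}$ the graph state is $|G\rangle=\prod_{ij\in E(G)}CZ_{ij}\,|+\rangle^{\otimes n}$. Two $n$-qubit states $|\psi\rangle,|\varphi\rangle$ are *locally Clifford equivalent* if $|\psi\rangle=c\,(U_1\otimes\cdots\otimes U_n)|\varphi\rangle$ for some $c\in\mathbb C$ with $|c|=1$ and some one-qubit Clifford unitaries $U_i$, i.e. elements of the group generated by the Hadamard gate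 and $\mathrm{diag}(1,i)$. **Theorem.** Let $n\ge0$ and let $|G\rangle,|H\rangle$ be $n$-qubit graph states. They are locally Clifford equivalent if and only if there is an ordering of the $n$ vertices (the same one for both graphs) such that the adjacency matrices $A$ of $G$ and $B$ of $H$ with respect to this ordering satisfy $$\exists\,u,v\in\mathbb F_2^n,\ k\in\{0,\dots,n\}:\quad \Gamma_k(B+D(v))\text{ is defined and } A+D(u)=\omega_1\big(\Gamma_k(B+D(v))\big).$$ -/

import Mathlib

/-! ### Matrices over `ZMod 4` and `ZMod 2` -/

namespace LCGraph

open Matrix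

/-- The `i`-th binary digit `⌊x / 2^(i-1)⌋ mod 2` (`i ≥ 1`) of `x ∈ {0,1,2,3}`. -/
def bit (i : ℕ) (x : ZMod 4) : ZMod 2 := ((x.val / 2 ^ (i - 1) : ℕ) : ZMod 2)

/-- The inclusion of the set `{0,1} = 𝔽₂` into `ℤ₄ = {0,1,2,3}` (not a ring homomorphism). -/
def lift (x : ZMod 2) : ZMod 4 := (x.val : ZMod 4)

/-- `ω₁` applied entrywise, with values in `𝔽₂`. -/
def omega1 {n m : ℕ} (A : Matrix (Fin n) (Fin m) (ZMod 4)) : Matrix (Fin n) (Fin m) (ZMod 2) :=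
  A.map (bit 1)

/-- `Ω₁,₂(A) = ω₁(A) + 2 ω₂(D(A))`: keep the first bit of every entry, and also the second bit
on the diagonal. -/
def Omega12 {n : ℕ} (A : Matrix (Fin n) (Fin n) (ZMod 4)) : Matrix (Fin n) (Fin n) (ZMod 4) :=
  (omega1 A).map lift + diagonal fun i => 2 * lift (bit 2 (A i i))

/-- The set `𝕁ₙ`: symmetric matrices over `ℤ₄` whose off-diagonal entries are in `{0,1}`. -/
def IsJ {n : ℕ} (A : Matrix (Fin n) (Fin n) (ZMod 4)) : Prop :=
  Omega12 A = A ∧ Aᵀ = A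

/-! ### LDL decompositions over `𝔽₂` -/

/-- `D` is block-diagonal with diagonal blocks `[0]`, `[1]` or `[0 1; 1 0]`. The map `b` sends an
index to the number of its block; blocks are consecutive (`Monotone b`) and have at most two
elements. -/
def IsPivotBlockDiagonal {n : ℕ} (D : Matrix (Fin n) (Fin n) (ZMod 2)) : Prop :=
  ∃ b : Fin n → ℕ, Monotone b ∧
    (∀ i j l, i < j → j < l → b i ≠ b l) ∧
    (∀ i j, b i ≠ b j → D i j = 0) ∧
    (∀ i j, i < j → b i = b j → D i i = 0 ∧ D i j = 1 ∧ D j i = 1 ∧ D j j = 0)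

/-- `(P, L, D)` is an LDL decomposition of `A` over `𝔽₂`; the permutation matrix is given by the
permutation `P`. -/
structure IsLDL {n : ℕ} (A : Matrix (Fin n) (Fin n) (ZMod 2)) (P : Equiv.Perm (Fin n))
    (L D : Matrix (Fin n) (Fin n) (ZMod 2)) : Prop where
  eq : A = P.permMatrix (ZMod 2) * L * D * Lᵀ * (P.permMatrix (ZMod 2))ᵀ
  unit_diag : ∀ i, L i i = 1
  lower : ∀ i j, i < j → L i j = 0
  block_diag : IsPivotBlockDiagonal D
  normalized : ∀ i j : Fin n, (j : ℕ) = i + 1 →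
    D i i = 0 → D i j = 1 → D j i = 1 → D j j = 0 → L j i = 0

/-- The set `𝕎ₙ`: matrices in `𝕁ₙ` whose reduction mod 2 has an LDL decomposition with `P = I`. -/
def IsW {n : ℕ} (A : Matrix (Fin n) (Fin n) (ZMod 4)) : Prop :=
  IsJ A ∧ ∃ L D, IsLDL (omega1 A) 1 L D

/-! ### The generalized Gauss–Jordan process -/

/-- The leading `k × k` block of an `n × n` matrix. -/
def leadingBlock {n : ℕ} {R : Type*} (A : Matrix (Fin n) (Fin n) R) (k : ℕ) (hk : k ≤ n) :
    Matrix (Fin k) (Fin k) R :=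
  A.submatrix (Fin.castLE hk) (Fin.castLE hk)

/-- One elimination step with pivot block `T`. Writing `B` in blocks with the indices in `T` first,
it is `Ω₁,₂ [B₁₁, ω₁(B₁₁) B₁₂; B₂₁ ω₁(B₁₁), B₂₂ - B₂₁ ω₁(B₁₁) B₁₂]`, after which the diagonal
entries in `T` are reduced to their first bit. (For a `1 × 1` pivot with `ω₁(B₁₁) = 1` the
off-diagonal blocks are just `B₁₂` and `B₂₁`.) -/
def eliminate {n : ℕ} (T : Finset (Fin n)) (B : Matrix (Fin n) (Fin n) (ZMod 4)) :
    Matrix (Fin n) (Fin n) (ZMod 4) :=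
  let w : ZMod 4 → ZMod 4 := fun x => lift (bit 1 x)
  let M : Matrix (Fin n) (Fin n) (ZMod 4) := Matrix.of fun i j =>
    if i ∈ T ∧ j ∈ T then B i j
    else if i ∈ T then ∑ c ∈ T, w (B i c) * B c j
    else if j ∈ T then ∑ c ∈ T, B i c * w (B c j)
    else B i j - ∑ c ∈ T, ∑ d ∈ T, B i c * w (B c d) * B d j
  let N := Omega12 M
  Matrix.of fun i j => if i = j ∧ i ∈ T then w (N i j) else N i j

/-- The main loop, with the (0-based) index `i` of the next row/column to be eliminated. If the
current diagonal entry is odd it is used as a `1 × 1` pivot, otherwise rows/columns `i, i+1` are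
used as a `2 × 2` pivot. (The last `else` is never reached on admissible inputs.) -/
def gaussJordanLoop {n : ℕ} (k : ℕ) (hk : k ≤ n) (i : ℕ)
    (B : Matrix (Fin n) (Fin n) (ZMod 4)) : Matrix (Fin n) (Fin n) (ZMod 4) :=
  if h : i < k then
    if bit 1 (B ⟨i, h.trans_le hk⟩ ⟨i, h.trans_le hk⟩) = 1 then
      gaussJordanLoop k hk (i + 1) (eliminate {⟨i, h.trans_le hk⟩} B)
    else if h' : i + 1 < n then
      gaussJordanLoop k hk (i + 2) (eliminate {⟨i, h.trans_le hk⟩, ⟨i + 1, h'⟩} B)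
    else B
  else B
termination_by k - i

/-- `Γ_k(A)`: the result of eliminating the first `k` rows/columns of `A`. -/
def Gamma {n : ℕ} (k : ℕ) (hk : k ≤ n) (A : Matrix (Fin n) (Fin n) (ZMod 4)) :
    Matrix (Fin n) (Fin n) (ZMod 4) :=
  gaussJordanLoop k hk 0 A

/-- The domain of `Γ_k`: `A ∈ 𝕎ₙ`, and the leading `k × k` block is in `𝕎ₖ` and has rank `k`
over `𝔽₂`. -/
structure GammaAdmissible {n : ℕ} (k : ℕ) (hk : k ≤ n)
    (A : Matrix (Fin n) (Fin n) (ZMod 4)) : Prop where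
  mem : IsW A
  mem_leading : IsW (leadingBlock A k hk)
  rank_leading : (omega1 (leadingBlock A k hk)).rank = k

/-! ### Graph states and local Clifford equivalence -/

/-- Vectors of `(ℂ²)^{⊗n}`, given by their coordinates in the computational basis. -/
abbrev QState (n : ℕ) : Type := (Fin n → Fin 2) → ℂ

/-- Linear operators on `(ℂ²)^{⊗n}`, as matrices in the computational basis. -/
abbrev QOp (n : ℕ) : Type := Matrix (Fin n → Fin 2) (Fin n → Fin 2) ℂ

/-- The state `|+⟩^{⊗n}`. -/
noncomputable def plusState (n : ℕ) : QState n :=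
  fun x => ∏ i, (![1 / (Real.sqrt 2 : ℂ), 1 / (Real.sqrt 2 : ℂ)] : Fin 2 → ℂ) (x i)

open Classical in
/-- The controlled-`Z` gate acting on the two qubits of the edge `e`: it multiplies the basis
state `|x⟩` by `-1` if both qubits of `e` are `1`, and fixes it otherwise. -/
noncomputable def czGate {n : ℕ} (e : Sym2 (Fin n)) : QOp n :=
  Matrix.diagonal fun x => if ∀ i ∈ e, x i = 1 then -1 else 1

theorem czGate_commute {n : ℕ} (e f : Sym2 (Fin n)) : Commute (czGate e) (czGate f) := by
  unfold Commute SemiconjBy czGate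
  rw [Matrix.diagonal_mul_diagonal, Matrix.diagonal_mul_diagonal]
  congr 1
  funext x
  exact mul_comm _ _

/-- The graph state `|G⟩ = ∏_{e ∈ E(G)} CZ_e |+⟩^{⊗n}`. -/
noncomputable def graphState {n : ℕ} (G : SimpleGraph (Fin n)) [DecidableRel G.Adj] : QState n :=
  (G.edgeFinset.noncommProd czGate fun e _ f _ _ => czGate_commute e f) *ᵥ plusState n

/-- The Hadamard gate. -/
noncomputable def hadamard : Matrix.unitaryGroup (Fin 2) ℂ :=
  ⟨(1 / (Real.sqrt 2 : ℂ)) • !![1, 1; 1, -1], by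
    have h : (Real.sqrt 2 : ℂ) * (Real.sqrt 2 : ℂ) = 2 := by
      rw [← Complex.ofReal_mul, Real.mul_self_sqrt (by norm_num)]; norm_num
    have h2 : ((Real.sqrt 2 : ℂ))⁻¹ * ((Real.sqrt 2 : ℂ))⁻¹ = 1 / 2 := by
      rw [← mul_inv, h]; norm_num
    rw [Matrix.mem_unitaryGroup_iff]
    ext i j
    fin_cases i <;> fin_cases j <;>
      simp [Matrix.mul_apply, Fin.sum_univ_two, Matrix.star_apply, h2] <;> norm_num⟩

/-- The phase gate `R_z(π/2) = diag(1, i)`. -/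
noncomputable def phaseGate : Matrix.unitaryGroup (Fin 2) ℂ :=
  ⟨!![1, 0; 0, Complex.I], by
    rw [Matrix.mem_unitaryGroup_iff]
    ext i j
    fin_cases i <;> fin_cases j <;>
      simp [Matrix.mul_apply, Fin.sum_univ_two, Matrix.star_apply]⟩

/-- The one-qubit Clifford unitaries (up to global phases): the group generated by the Hadamard
gate and the phase gate. -/
noncomputable def cliffordOne : Subgroup (Matrix.unitaryGroup (Fin 2) ℂ) :=
  Subgroup.closure {hadamard, phaseGate}

/-- The operator `U₁ ⊗ ⋯ ⊗ Uₙ`. -/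
def tensorOp {n : ℕ} (U : Fin n → Matrix (Fin 2) (Fin 2) ℂ) : QOp n :=
  Matrix.of fun x y => ∏ i, U i (x i) (y i)

/-- Local Clifford equivalence of two states; as usual, states are considered up to a global
phase `c`. -/
def LCEquivalent {n : ℕ} (ψ φ : QState n) : Prop :=
  ∃ U : Fin n → Matrix.unitaryGroup (Fin 2) ℂ, (∀ i, U i ∈ cliffordOne) ∧
    ∃ c : ℂ, ‖c‖ = 1 ∧
      ψ = c • (tensorOp (fun i => (U i : Matrix (Fin 2) (Fin 2) ℂ)) *ᵥ φ)

end LCGraph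

/-!
Only the reduction modulo two of the elimination process matters for the statement, because
`bit 1 : ZMod 4 → ZMod 2` is a ring homomorphism. Modulo two, eliminating a pivot block `T` is a
principal pivot transform (`isPivotTransform_eliminate`): `A` is the pivot transform of `B` on `K`
when exchanging the coordinates in `K` between `r` and `B r` turns the graph `{(r, B r)}` into
`{(r, A r)}`. Such transforms on disjoint sets compose, so that `Γ_k` computes the pivot transform
on the first `k` indices (`GammaAdmissible.isPivotTransform`); the LDL decomposition of the leading
block guarantees that every pivot used by the loop is `[1]` or `[0 1; 1 0]`.

On the quantum side, the Pauli operators `Zˢ Xʳ` that have the graph state of `A` as an eigenvector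
are exactly those with `s = A r` (`isPauliEigenvector_graphState`), and this property determines the
graph state up to a scalar and Pauli `Z` operators (`exists_eq_smul_graphState`). A one-qubit
Clifford unitary acts on the exponents `(r, s)` through an element of `GL₂(𝔽₂)`, which is either a
shear `(r, s) ↦ (r, s + α r)` or the exchange of `r` and `s` between two shears. The shears add
diagonal matrices to the adjacency matrices and the exchanges form the set `K` of a pivot transform,
so two graph states are locally Clifford equivalent if and only if their adjacency matrices, with
suitable diagonals, are related by a pivot transform (`lcEquivalent_graphState_iff`).

It remains to order the vertices so that `K` comes first and the input of `Γ_k` is admissible. The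
block on `K` is nonsingular, and by induction one can always pick a `1 × 1` or `2 × 2` pivot, inside
`K` as long as that set is not exhausted (`exists_hasLDL_submatrix`).
-/

namespace LCGraph

open Matrix

/-! ### Principal pivot transforms over `𝔽₂` -/

section PivotTransform

variable {ι : Type*} [Fintype ι] [DecidableEq ι]

/-- `A` is the principal pivot transform of `B` on the index set `K`: exchanging the coordinates in
`K` between `r` and `B r` turns the graph of `B` into the graph of `A`. Stating this through
graphs avoids inverting the block of `B` on `K`, whose invertibility is a consequence. -/
def IsPivotTransform (K : Finset ι) (A B : Matrix ι ι (ZMod 2)) : Prop :=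
  ∀ r : ι → ZMod 2, A *ᵥ K.piecewise (B *ᵥ r) r = K.piecewise r (B *ᵥ r)

theorem IsPivotTransform.refl (B : Matrix ι ι (ZMod 2)) : IsPivotTransform ∅ B B := by
  intro r
  simp

theorem IsPivotTransform.union {K T : Finset ι} (hKT : Disjoint K T)
    {A B C : Matrix ι ι (ZMod 2)} (h₁ : IsPivotTransform T A B) (h₂ : IsPivotTransform K B C) :
    IsPivotTransform (K ∪ T) A C := by
  intro r
  have h := h₁ (K.piecewise (C *ᵥ r) r)
  rw [h₂ r] at h
  convert h using 1
  · congr 1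
    ext x
    by_cases hK : x ∈ K
    · have := Finset.disjoint_left.mp hKT hK
      simp [Finset.piecewise, hK, this]
    · simp [Finset.piecewise, hK]
  · ext x
    by_cases hK : x ∈ K
    · have := Finset.disjoint_left.mp hKT hK
      simp [Finset.piecewise, hK, this]
    · simp [Finset.piecewise, hK]

theorem IsPivotTransform.injective {K : Finset ι} {A B : Matrix ι ι (ZMod 2)}
    (h : IsPivotTransform K A B) :
    Function.Injective fun r : ι → ZMod 2 => K.piecewise (B *ᵥ r) r := by
  intro r r' hr
  have hA := congrArg (A *ᵥ ·) hr
  simp only [h r, h r'] at hA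
  ext x
  by_cases hx : x ∈ K
  · simpa [hx] using congrFun hA x
  · simpa [hx] using congrFun hr x

theorem IsPivotTransform.surjective {K : Finset ι} {A B : Matrix ι ι (ZMod 2)}
    (h : IsPivotTransform K A B) :
    Function.Surjective fun r : ι → ZMod 2 => K.piecewise (B *ᵥ r) r :=
  Finite.surjective_of_injective h.injective

theorem IsPivotTransform.unique {K : Finset ι} {A A' B : Matrix ι ι (ZMod 2)}
    (h : IsPivotTransform K A B) (h' : IsPivotTransform K A' B) : A = A' := by
  apply Matrix.mulVec_injective
  funext s
  obtain ⟨r, rfl⟩ := h.surjective s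
  exact (h r).trans (h' r).symm

/-- The block on `K` of a matrix with a pivot transform on `K` is nonsingular. -/
theorem IsPivotTransform.nonsingular {K : Finset ι} {A B : Matrix ι ι (ZMod 2)}
    (h : IsPivotTransform K A B) (r : ι → ZMod 2) (hr : ∀ x ∉ K, r x = 0)
    (hB : ∀ x ∈ K, (B *ᵥ r) x = 0) : r = 0 := by
  apply h.injective
  ext x
  by_cases hx : x ∈ K
  · simp [hx, hB x hx]
  · simp [hx, hr x hx]

theorem IsPivotTransform.submatrix {κ : Type*} [Fintype κ] [DecidableEq κ] (e : κ ≃ ι)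
    {K : Finset ι} {A B : Matrix ι ι (ZMod 2)} (h : IsPivotTransform K A B) {K' : Finset κ}
    (hK : ∀ x, x ∈ K' ↔ e x ∈ K) :
    IsPivotTransform K' (A.submatrix e e) (B.submatrix e e) := by
  intro r
  rw [submatrix_mulVec_equiv, submatrix_mulVec_equiv]
  have h₁ : K'.piecewise ((B *ᵥ r ∘ e.symm) ∘ e) r ∘ e.symm =
      K.piecewise (B *ᵥ r ∘ e.symm) (r ∘ e.symm) := by
    ext x
    simp [Finset.piecewise, hK]
  rw [h₁, h (r ∘ e.symm)]
  ext x
  simp [Finset.piecewise, hK]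

end PivotTransform

/-! ### Reduction of an elimination step modulo two -/

/-- `bit 1` is reduction modulo `2`. -/
theorem bit_one (x : ZMod 4) : bit 1 x = ZMod.castHom (show 2 ∣ 4 by norm_num) (ZMod 2) x := by
  revert x
  decide

@[simp] theorem bit_one_lift (x : ZMod 2) : bit 1 (lift x) = x := by
  revert x
  decide

theorem bit_one_sub (x y : ZMod 4) : bit 1 (x - y) = bit 1 x - bit 1 y := by
  simp only [bit_one, map_sub]

theorem bit_one_mul (x y : ZMod 4) : bit 1 (x * y) = bit 1 x * bit 1 y := by
  simp only [bit_one, map_mul]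

theorem bit_one_sum {α : Type*} (s : Finset α) (f : α → ZMod 4) :
    bit 1 (∑ x ∈ s, f x) = ∑ x ∈ s, bit 1 (f x) := by
  simp only [bit_one, map_sum]

theorem omega1_Omega12 {n : ℕ} (A : Matrix (Fin n) (Fin n) (ZMod 4)) :
    omega1 (Omega12 A) = omega1 A := by
  have h (x y : ZMod 2) : bit 1 (lift x + 2 * lift y) = x := by
    revert x y
    decide
  ext i j
  by_cases hij : i = j
  · subst hij
    simp [omega1, Omega12, h]
  · simp [omega1, Omega12, hij]

/-- The reduction of `eliminate` modulo two; the corrections to the second bits disappear. -/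
theorem omega1_eliminate {n : ℕ} (T : Finset (Fin n)) (B : Matrix (Fin n) (Fin n) (ZMod 4))
    (i j : Fin n) :
    omega1 (eliminate T B) i j =
      if i ∈ T ∧ j ∈ T then omega1 B i j
      else if i ∈ T then ∑ c ∈ T, omega1 B i c * omega1 B c j
      else if j ∈ T then ∑ c ∈ T, omega1 B i c * omega1 B c j
      else omega1 B i j - ∑ c ∈ T, ∑ d ∈ T, omega1 B i c * omega1 B c d * omega1 B d j := by
  have key (M : Matrix (Fin n) (Fin n) (ZMod 4)) :
      omega1 (Matrix.of fun i j => if i = j ∧ i ∈ T then lift (bit 1 (Omega12 M i j))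
        else Omega12 M i j) = omega1 M := by
    rw [← omega1_Omega12 M]
    ext i j
    simp only [omega1, map_apply, of_apply]
    split_ifs <;> simp
  unfold eliminate
  simp only [key]
  simp only [omega1, map_apply, of_apply]
  split_ifs <;> simp only [bit_one_sub, bit_one_sum, bit_one_mul, bit_one_lift]

/-- Eliminating a pivot block `T` that is its own inverse modulo two is a principal pivot
transform. -/
theorem isPivotTransform_eliminate {n : ℕ} (T : Finset (Fin n))
    (B : Matrix (Fin n) (Fin n) (ZMod 4))
    (hT : ∀ i ∈ T, ∀ j ∈ T, ∑ c ∈ T, omega1 B i c * omega1 B c j = if i = j then 1 else 0) :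
    IsPivotTransform T (omega1 (eliminate T B)) (omega1 B) := by
  intro r
  set N := omega1 B with hN
  have two (x : ZMod 2) : x + x = 0 := CharTwo.add_self_eq_zero x
  -- The part of `N r` coming from the coordinates outside `T`.
  set q : Fin n → ZMod 2 := fun i => ∑ d ∈ Tᶜ, N i d * r d with hq
  have split (f : Fin n → ZMod 2) : ∑ d, f d = ∑ d ∈ T, f d + ∑ d ∈ Tᶜ, f d :=
    (Finset.sum_add_sum_compl T f).symm
  have hNr (i : Fin n) : (N *ᵥ r) i = ∑ d ∈ T, N i d * r d + q i := by
    simp only [mulVec, dotProduct, split, hq]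
  have hWW (i : Fin n) (hi : i ∈ T) (g : Fin n → ZMod 2) :
      ∑ c ∈ T, N i c * ∑ d ∈ T, N c d * g d = g i := by
    simp only [Finset.mul_sum]
    rw [Finset.sum_comm]
    simp only [← mul_assoc, ← Finset.sum_mul]
    rw [Finset.sum_congr rfl fun d hd => by rw [hT i hi d hd]]
    simp [hi]
  ext i
  have hin : ∑ d ∈ T, omega1 (eliminate T B) i d * T.piecewise (N *ᵥ r) r d =
      ∑ d ∈ T, omega1 (eliminate T B) i d * (N *ᵥ r) d :=
    Finset.sum_congr rfl fun d hd => by simp [hd]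
  have hout : ∑ d ∈ Tᶜ, omega1 (eliminate T B) i d * T.piecewise (N *ᵥ r) r d =
      ∑ d ∈ Tᶜ, omega1 (eliminate T B) i d * r d :=
    Finset.sum_congr rfl fun d hd => by simp [Finset.mem_compl.mp hd]
  have hL : (omega1 (eliminate T B) *ᵥ T.piecewise (N *ᵥ r) r) i =
      ∑ d ∈ T, omega1 (eliminate T B) i d * (N *ᵥ r) d +
        ∑ d ∈ Tᶜ, omega1 (eliminate T B) i d * r d := by
    simp only [mulVec, dotProduct] at hin hout ⊢
    rw [split, hin, hout]
  rw [hL]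
  by_cases hi : i ∈ T
  · have h₁ : ∑ d ∈ T, omega1 (eliminate T B) i d * (N *ᵥ r) d =
        r i + ∑ d ∈ T, N i d * q d := by
      rw [Finset.sum_congr rfl fun d hd => by
        rw [omega1_eliminate, if_pos ⟨hi, hd⟩, hNr, mul_add], Finset.sum_add_distrib, hWW i hi]
    have h₂ : ∑ d ∈ Tᶜ, omega1 (eliminate T B) i d * r d = ∑ d ∈ T, N i d * q d := by
      rw [Finset.sum_congr rfl fun d hd => by
        rw [omega1_eliminate, if_neg (fun h => Finset.mem_compl.mp hd h.2), if_pos hi]]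
      simp only [hq, Finset.mul_sum, Finset.sum_mul, mul_assoc]
      exact Finset.sum_comm
    rw [h₁, h₂, Finset.piecewise_eq_of_mem _ _ _ hi, add_assoc, two, add_zero]
  · have h₁ : ∑ d ∈ T, omega1 (eliminate T B) i d * (N *ᵥ r) d =
        ∑ d ∈ T, N i d * r d + ∑ c ∈ T, N i c * ∑ d ∈ T, N c d * q d := by
      rw [Finset.sum_congr rfl fun d hd => by
        rw [omega1_eliminate, if_neg (fun h => hi h.1), if_neg hi, if_pos hd]]
      simp only [Finset.sum_mul, mul_assoc]
      rw [Finset.sum_comm, ← Finset.sum_add_distrib]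
      refine Finset.sum_congr rfl fun c hc => ?_
      rw [← Finset.mul_sum, ← mul_add]
      congr 1
      simp only [hNr, mul_add, Finset.sum_add_distrib]
      rw [hWW c hc]
    have h₂ : ∑ d ∈ Tᶜ, omega1 (eliminate T B) i d * r d =
        q i - ∑ c ∈ T, N i c * ∑ d ∈ T, N c d * q d := by
      rw [Finset.sum_congr rfl fun d hd => by
        rw [omega1_eliminate, if_neg (fun h => hi h.1), if_neg hi,
          if_neg (Finset.mem_compl.mp hd), sub_mul], Finset.sum_sub_distrib]
      congr 1
      simp only [hq, Finset.mul_sum, Finset.sum_mul, mul_assoc]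
      rw [Finset.sum_comm]
      refine Finset.sum_congr rfl fun c _ => ?_
      rw [Finset.sum_comm]
    rw [h₁, h₂, Finset.piecewise_eq_of_notMem _ _ _ hi, hNr]
    ring

/-! ### Correctness of the elimination loop -/

theorem eq_one_of_ne_zero_zmod_two {x : ZMod 2} (hx : x ≠ 0) : x = 1 := by
  revert x
  decide

/-- The part of `L D Lᵀ` contributed by the rows and columns of `D` with index at least `i`. When
`i` starts a block of `D`, it is, on the indices at least `i`, the Schur complement left after
eliminating the first `i` rows and columns of `L D Lᵀ`. -/
def tailProduct {k : ℕ} (L D : Matrix (Fin k) (Fin k) (ZMod 2)) (i : ℕ) (a b : Fin k) : ZMod 2 :=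
  ∑ c ∈ Finset.univ.filter (fun c : Fin k => i ≤ c),
    ∑ d ∈ Finset.univ.filter (fun d : Fin k => i ≤ d), L a c * D c d * L b d

section Tail

variable {k : ℕ} {L D : Matrix (Fin k) (Fin k) (ZMod 2)}

theorem tailProduct_zero (a b : Fin k) : tailProduct L D 0 a b = (L * D * Lᵀ) a b := by
  simp only [tailProduct, Nat.zero_le, Finset.filter_true, mul_apply, transpose_apply,
    Finset.sum_mul]
  exact Finset.sum_comm

theorem tailProduct_eq_zero_right (hL : ∀ i j, i < j → L i j = 0) {i : ℕ} (a b : Fin k)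
    (hb : b < i) : tailProduct L D i a b = 0 := by
  refine Finset.sum_eq_zero fun c _ => Finset.sum_eq_zero fun d hd => ?_
  rw [hL b d (by have := (Finset.mem_filter.mp hd).2; exact Fin.lt_def.mpr (by omega)), mul_zero]

theorem tailProduct_eq_zero_left (hL : ∀ i j, i < j → L i j = 0) {i : ℕ} (a b : Fin k)
    (ha : a < i) : tailProduct L D i a b = 0 := by
  refine Finset.sum_eq_zero fun c hc => Finset.sum_eq_zero fun d _ => ?_
  rw [hL a c (by have := (Finset.mem_filter.mp hc).2; exact Fin.lt_def.mpr (by omega)), zero_mul,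
    zero_mul]

theorem filter_le_eq_insert {i : ℕ} (hi : i < k) :
    Finset.univ.filter (fun c : Fin k => i ≤ c) =
      insert ⟨i, hi⟩ (Finset.univ.filter fun c : Fin k => i + 1 ≤ c) := by
  ext c
  simp only [Finset.mem_filter, Finset.mem_univ, true_and, Finset.mem_insert, Fin.ext_iff]
  omega

theorem tailProduct_one {i : ℕ} (hi : i < k) (hD : D ⟨i, hi⟩ ⟨i, hi⟩ = 1)
    (hrow : ∀ d : Fin k, i < d → D ⟨i, hi⟩ d = 0) (hcol : ∀ d : Fin k, i < d → D d ⟨i, hi⟩ = 0)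
    (a b : Fin k) :
    tailProduct L D i a b = L a ⟨i, hi⟩ * L b ⟨i, hi⟩ + tailProduct L D (i + 1) a b := by
  have hn : (⟨i, hi⟩ : Fin k) ∉ Finset.univ.filter fun c : Fin k => i + 1 ≤ c := by simp
  unfold tailProduct
  rw [filter_le_eq_insert hi, Finset.sum_insert hn, Finset.sum_insert hn, hD, mul_one,
    Finset.sum_eq_zero (s := Finset.univ.filter fun c : Fin k => i + 1 ≤ c)
      (fun d hd => by rw [hrow d (Finset.mem_filter.mp hd).2]; ring), add_zero]
  congr 1
  refine Finset.sum_congr rfl fun c hc => ?_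
  rw [Finset.sum_insert hn, hcol c (Finset.mem_filter.mp hc).2]
  ring

theorem tailProduct_two {i : ℕ} (hi : i + 1 < k)
    (h₁₁ : D ⟨i, by omega⟩ ⟨i, by omega⟩ = 0) (h₁₂ : D ⟨i, by omega⟩ ⟨i + 1, hi⟩ = 1)
    (h₂₁ : D ⟨i + 1, hi⟩ ⟨i, by omega⟩ = 1) (h₂₂ : D ⟨i + 1, hi⟩ ⟨i + 1, hi⟩ = 0)
    (hrow₁ : ∀ d : Fin k, i + 1 < d → D ⟨i, by omega⟩ d = 0)
    (hcol₁ : ∀ d : Fin k, i + 1 < d → D d ⟨i, by omega⟩ = 0)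
    (hrow₂ : ∀ d : Fin k, i + 1 < d → D ⟨i + 1, hi⟩ d = 0)
    (hcol₂ : ∀ d : Fin k, i + 1 < d → D d ⟨i + 1, hi⟩ = 0) (a b : Fin k) :
    tailProduct L D i a b = L a ⟨i, by omega⟩ * L b ⟨i + 1, hi⟩ +
      L a ⟨i + 1, hi⟩ * L b ⟨i, by omega⟩ + tailProduct L D (i + 2) a b := by
  have hi' : i < k := by omega
  have hn₁ : (⟨i, hi'⟩ : Fin k) ∉
      insert ⟨i + 1, hi⟩ (Finset.univ.filter fun c : Fin k => i + 2 ≤ c) := by simp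
  have hn₂ : (⟨i + 1, hi⟩ : Fin k) ∉ Finset.univ.filter fun c : Fin k => i + 2 ≤ c := by simp
  unfold tailProduct
  rw [filter_le_eq_insert hi', filter_le_eq_insert hi]
  simp only [Finset.sum_insert hn₁, Finset.sum_insert hn₂, h₁₁, h₁₂, h₂₁, h₂₂]
  rw [Finset.sum_eq_zero (s := Finset.univ.filter fun c : Fin k => i + 2 ≤ c)
      (fun d hd => by rw [hrow₁ d (Finset.mem_filter.mp hd).2]; ring),
    Finset.sum_eq_zero (s := Finset.univ.filter fun c : Fin k => i + 2 ≤ c)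
      (fun d hd => by rw [hrow₂ d (Finset.mem_filter.mp hd).2]; ring),
    Finset.sum_congr (s₁ := Finset.univ.filter fun c : Fin k => i + 2 ≤ c) rfl
      (fun c hc => by
        rw [hcol₁ c (Finset.mem_filter.mp hc).2, hcol₂ c (Finset.mem_filter.mp hc).2])]
  simp only [mul_zero, zero_mul, zero_add, mul_one, add_zero]
  ring

end Tail

/-- The loop started at the beginning `i` of a block computes the pivot transform on the indices
from `i` to `k - 1`, provided that the remaining part of the leading block is the tail of an LDL
decomposition whose `D` has no zero row. The pivots found by the loop are then the blocks of `D`. -/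
theorem isPivotTransform_gaussJordanLoop {n k : ℕ} (hk : k ≤ n)
    {L D : Matrix (Fin k) (Fin k) (ZMod 2)} (hdiag : ∀ i, L i i = 1)
    (hlower : ∀ i j, i < j → L i j = 0)
    (hnorm : ∀ i j : Fin k, (j : ℕ) = i + 1 →
      D i i = 0 → D i j = 1 → D j i = 1 → D j j = 0 → L j i = 0)
    {β : Fin k → ℕ} (hβ₃ : ∀ i j l, i < j → j < l → β i ≠ β l)
    (hβ₀ : ∀ i j, β i ≠ β j → D i j = 0)
    (hβ₂ : ∀ i j, i < j → β i = β j → D i i = 0 ∧ D i j = 1 ∧ D j i = 1 ∧ D j j = 0)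
    (hrow : ∀ i, ∃ j, D i j ≠ 0) (i : ℕ) (B : Matrix (Fin n) (Fin n) (ZMod 4))
    (hstart : ∀ a b : Fin k, a < i → i ≤ b → β a ≠ β b)
    (htail : ∀ a b : Fin k, i ≤ a → i ≤ b →
      omega1 B (Fin.castLE hk a) (Fin.castLE hk b) = tailProduct L D i a b) :
    IsPivotTransform (Finset.univ.filter fun x : Fin n => i ≤ x ∧ x < k)
      (omega1 (gaussJordanLoop k hk i B)) (omega1 B) := by
  induction hm : k - i using Nat.strong_induction_on generalizing i B with
  | _ m IH =>
  subst hm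
  rw [gaussJordanLoop]
  split_ifs with h hpiv h'
  · -- a `1 × 1` pivot
    have hpiv' : omega1 B (Fin.castLE hk ⟨i, h⟩) (Fin.castLE hk ⟨i, h⟩) = 1 := hpiv
    have hsingle : ∀ d : Fin k, i < d → β ⟨i, h⟩ ≠ β d := by
      intro d hd heq
      obtain ⟨h₁, h₂, h₃, h₄⟩ := hβ₂ ⟨i, h⟩ d hd heq
      -- inside a `2 × 2` block the Schur complement has diagonal entry `0`
      have hd' : (d : ℕ) = i + 1 := by
        by_contra hne
        exact hβ₃ ⟨i, h⟩ ⟨i + 1, by omega⟩ d (Fin.lt_def.mpr (by simp))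
          (Fin.lt_def.mpr (by simp only; omega)) heq
      have hik : i + 1 < k := by have := d.2; omega
      have hd'' : d = ⟨i + 1, hik⟩ := Fin.ext hd'
      subst hd''
      rw [htail _ _ le_rfl le_rfl, tailProduct_two (by omega) h₁ h₂ h₃ h₄
        (fun e he => hβ₀ _ _ (hβ₃ _ ⟨i + 1, hik⟩ _ (Fin.lt_def.mpr (by simp)) he))
        (fun e he => hβ₀ _ _ (hβ₃ _ ⟨i + 1, hik⟩ _ (Fin.lt_def.mpr (by simp)) he).symm)
        (fun e he => hβ₀ _ _ fun h5 =>
          hβ₃ _ ⟨i + 1, hik⟩ _ (Fin.lt_def.mpr (by simp)) he (heq.trans h5))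
        (fun e he => hβ₀ _ _ fun h5 =>
          hβ₃ _ ⟨i + 1, hik⟩ _ (Fin.lt_def.mpr (by simp)) he (heq.trans h5.symm)),
        tailProduct_eq_zero_left hlower _ _ (by simp), hlower ⟨i, h⟩ ⟨i + 1, hik⟩ hd] at hpiv'
      simp at hpiv'
    have hD : D ⟨i, h⟩ ⟨i, h⟩ = 1 := by
      obtain ⟨j, hj⟩ := hrow ⟨i, h⟩
      have hji : β ⟨i, h⟩ = β j := by
        by_contra hne
        exact hj (hβ₀ _ _ hne)
      rcases lt_trichotomy (j : ℕ) i with hlt | heq | hgt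
      · exact absurd hji.symm (hstart j ⟨i, h⟩ hlt le_rfl)
      · have : j = ⟨i, h⟩ := Fin.ext heq
        subst this
        exact eq_one_of_ne_zero_zmod_two hj
      · exact absurd hji (hsingle j hgt)
    have hT (a b : Fin k) := tailProduct_one (L := L) h hD (fun d hd => hβ₀ _ _ (hsingle d hd))
      (fun d hd => hβ₀ _ _ (hsingle d hd).symm) a b
    have hstep := isPivotTransform_eliminate {Fin.castLE hk ⟨i, h⟩} B (by
      simp only [Finset.mem_singleton, forall_eq, Finset.sum_singleton, if_true, hpiv', mul_one])
    have hrest := IH (k - (i + 1)) (by omega) (i + 1) (eliminate {Fin.castLE hk ⟨i, h⟩} B)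
      (by
        intro a b ha hb
        rcases Nat.lt_succ_iff_lt_or_eq.mp ha with ha | ha
        · exact hstart a b ha (by omega)
        · have : a = ⟨i, h⟩ := Fin.ext ha
          subst this
          exact hsingle b hb)
      (by
        intro a b ha hb
        have hai : Fin.castLE hk a ∉ ({Fin.castLE hk ⟨i, h⟩} : Finset (Fin n)) := by
          simp only [Finset.mem_singleton, Fin.ext_iff, Fin.val_castLE]; omega
        have hbi : Fin.castLE hk b ∉ ({Fin.castLE hk ⟨i, h⟩} : Finset (Fin n)) := by
          simp only [Finset.mem_singleton, Fin.ext_iff, Fin.val_castLE]; omega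
        rw [omega1_eliminate, if_neg (fun h => hai h.1), if_neg hai, if_neg hbi]
        simp only [Finset.sum_singleton]
        rw [hpiv', htail a b (by omega) (by omega), htail a _ (by omega) le_rfl,
          htail _ b le_rfl (by omega), hT, hT, hT,
          tailProduct_eq_zero_left hlower ⟨i, h⟩ b (by simp),
          tailProduct_eq_zero_right hlower a ⟨i, h⟩ (by simp), hdiag]
        ring) rfl
    have hp_eq : ({⟨i, h.trans_le hk⟩} : Finset (Fin n)) = {Fin.castLE hk ⟨i, h⟩} := rfl
    rw [hp_eq]
    convert IsPivotTransform.union (Finset.disjoint_singleton_left.mpr (by simp)) hrest hstep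
      using 1
    ext x
    simp only [Finset.mem_filter, Finset.mem_univ, true_and, Finset.mem_union,
      Finset.mem_singleton, Fin.ext_iff, Fin.val_castLE]
    omega
  · -- a `2 × 2` pivot
    have hpiv' : ¬ omega1 B (Fin.castLE hk ⟨i, h⟩) (Fin.castLE hk ⟨i, h⟩) = 1 := hpiv
    obtain ⟨j, hj⟩ := hrow ⟨i, h⟩
    have hji : β ⟨i, h⟩ = β j := by
      by_contra hne
      exact hj (hβ₀ _ _ hne)
    have hij : i < j := by
      rcases lt_trichotomy (j : ℕ) i with hlt | heq | hgt
      · exact absurd hji.symm (hstart j ⟨i, h⟩ hlt le_rfl)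
      · have : j = ⟨i, h⟩ := Fin.ext heq
        subst this
        have hsingle : ∀ d : Fin k, i < d → β ⟨i, h⟩ ≠ β d := fun d hd heq =>
          hj (hβ₂ _ d hd heq).1
        refine absurd ?_ hpiv'
        rw [htail _ _ le_rfl le_rfl, tailProduct_one h (eq_one_of_ne_zero_zmod_two hj)
          (fun d hd => hβ₀ _ _ (hsingle d hd)) (fun d hd => hβ₀ _ _ (hsingle d hd).symm),
          tailProduct_eq_zero_left hlower _ _ (by simp), hdiag]
        ring
      · exact hgt
    have hj' : (j : ℕ) = i + 1 := by
      by_contra hne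
      exact hβ₃ ⟨i, h⟩ ⟨i + 1, by omega⟩ j (Fin.lt_def.mpr (by simp))
        (Fin.lt_def.mpr (by simp only; omega)) hji
    have hik : i + 1 < k := by omega
    have hj'' : j = ⟨i + 1, hik⟩ := Fin.ext hj'
    subst hj''
    obtain ⟨h₁, h₂, h₃, h₄⟩ := hβ₂ _ _ (Fin.lt_def.mpr hij) hji
    have hL : L ⟨i + 1, hik⟩ ⟨i, h⟩ = 0 := hnorm _ _ rfl h₁ h₂ h₃ h₄
    have hL' : L ⟨i, h⟩ ⟨i + 1, hik⟩ = 0 := hlower _ _ (Fin.lt_def.mpr hij)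
    have hout₁ (e : Fin k) (he : i + 1 < e) : β ⟨i, h⟩ ≠ β e :=
      hβ₃ _ ⟨i + 1, hik⟩ _ (Fin.lt_def.mpr hij) he
    have hout₂ (e : Fin k) (he : i + 1 < e) : β ⟨i + 1, hik⟩ ≠ β e :=
      fun h5 => hout₁ e he (hji.trans h5)
    have hT (a b : Fin k) := tailProduct_two (L := L) hik h₁ h₂ h₃ h₄
      (fun e he => hβ₀ _ _ (hout₁ e he)) (fun e he => hβ₀ _ _ (hout₁ e he).symm)
      (fun e he => hβ₀ _ _ (hout₂ e he)) (fun e he => hβ₀ _ _ (hout₂ e he).symm) a b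
    set p : Fin n := Fin.castLE hk ⟨i, h⟩ with hp
    set q : Fin n := Fin.castLE hk ⟨i + 1, hik⟩ with hq
    have hpq : p ≠ q := by simp [hp, hq, Fin.ext_iff]
    have hpa (a : Fin k) (ha : i ≤ a) : omega1 B p (Fin.castLE hk a) = L a ⟨i + 1, hik⟩ := by
      rw [htail _ _ le_rfl ha, hT, tailProduct_eq_zero_left hlower _ _ (by simp), hL', hdiag]
      ring
    have hap (a : Fin k) (ha : i ≤ a) : omega1 B (Fin.castLE hk a) p = L a ⟨i + 1, hik⟩ := by
      rw [htail _ _ ha le_rfl, hT, tailProduct_eq_zero_right hlower _ _ (by simp), hL', hdiag]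
      ring
    have hqa (a : Fin k) (ha : i ≤ a) : omega1 B q (Fin.castLE hk a) = L a ⟨i, h⟩ := by
      rw [htail _ _ (by simp) ha, hT, tailProduct_eq_zero_left hlower _ _ (by simp), hL, hdiag]
      ring
    have haq (a : Fin k) (ha : i ≤ a) : omega1 B (Fin.castLE hk a) q = L a ⟨i, h⟩ := by
      rw [htail _ _ ha (by simp), hT, tailProduct_eq_zero_right hlower _ _ (by simp), hL, hdiag]
      ring
    have hpp : omega1 B p p = 0 := by rw [hp, hpa _ le_rfl, hL']
    have hpq' : omega1 B p q = 1 := by rw [hq, hpa _ (by simp), hdiag]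
    have hqp : omega1 B q p = 1 := by rw [hp, hqa _ le_rfl, hdiag]
    have hqq : omega1 B q q = 0 := by rw [hq, hqa _ (by simp), hL]
    have hstep := isPivotTransform_eliminate {p, q} B (by
      simp only [Finset.mem_insert, Finset.mem_singleton, forall_eq_or_imp, forall_eq,
        Finset.sum_pair hpq, hpp, hpq', hqp, hqq, if_true, hpq, hpq.symm, if_false]
      simp)
    have hrest := IH (k - (i + 2)) (by omega) (i + 2) (eliminate {p, q} B)
      (by
        intro a b ha hb
        rcases Nat.lt_succ_iff_lt_or_eq.mp ha with ha | ha
        · rcases Nat.lt_succ_iff_lt_or_eq.mp ha with ha | ha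
          · exact hstart a b ha (by omega)
          · have : a = ⟨i, h⟩ := Fin.ext ha
            subst this
            exact hout₁ b hb
        · have : a = ⟨i + 1, hik⟩ := Fin.ext ha
          subst this
          exact hout₂ b hb)
      (by
        intro a b ha hb
        have hai : Fin.castLE hk a ∉ ({p, q} : Finset (Fin n)) := by
          simp [hp, hq, Fin.ext_iff]; omega
        have hbi : Fin.castLE hk b ∉ ({p, q} : Finset (Fin n)) := by
          simp [hp, hq, Fin.ext_iff]; omega
        rw [omega1_eliminate, if_neg (fun h => hai h.1), if_neg hai, if_neg hbi]
        simp only [Finset.sum_pair hpq]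
        rw [hpp, hpq', hqp, hqq, htail a b (by omega) (by omega), hpa b (by omega),
          hap a (by omega), hqa b (by omega), haq a (by omega), hT]
        ring) rfl
    have hpq_eq : ({⟨i, h.trans_le hk⟩, ⟨i + 1, h'⟩} : Finset (Fin n)) = {p, q} := rfl
    rw [hpq_eq]
    have hdisj : Disjoint {p, q} (Finset.univ.filter fun x : Fin n => i + 2 ≤ x ∧ x < k) := by
      rw [Finset.disjoint_left]
      simp [hp, hq]
    convert IsPivotTransform.union hdisj hrest hstep using 1
    ext x
    simp only [Finset.mem_filter, Finset.mem_univ, true_and, Finset.mem_union,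
      Finset.mem_singleton, Finset.mem_insert, Fin.ext_iff, hp, hq, Fin.val_castLE]
    omega
  · -- a last row without partner would be a zero row of `D`
    exfalso
    obtain ⟨j, hj⟩ := hrow ⟨i, h⟩
    have hji : β ⟨i, h⟩ = β j := by
      by_contra hne
      exact hj (hβ₀ _ _ hne)
    rcases lt_trichotomy (j : ℕ) i with hlt | heq | hgt
    · exact hstart j ⟨i, h⟩ hlt le_rfl hji.symm
    · have : j = ⟨i, h⟩ := Fin.ext heq
      subst this
      apply hpiv
      change omega1 B (Fin.castLE hk ⟨i, h⟩) (Fin.castLE hk ⟨i, h⟩) = 1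
      rw [htail _ _ le_rfl le_rfl, tailProduct_one h (eq_one_of_ne_zero_zmod_two hj)
        (fun d hd => by have := d.2; simp only at *; omega)
        (fun d hd => by have := d.2; simp only at *; omega),
        tailProduct_eq_zero_left hlower _ _ (by simp), hdiag]
      ring
    · have := j.2
      omega
  · convert IsPivotTransform.refl (omega1 B) using 1
    ext x
    simp
    omega

/-- On its domain, `Γ_k` computes modulo two the pivot transform on the first `k` indices. -/
theorem GammaAdmissible.isPivotTransform {n k : ℕ} {hk : k ≤ n}
    {A : Matrix (Fin n) (Fin n) (ZMod 4)} (h : GammaAdmissible k hk A) :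
    IsPivotTransform (Finset.univ.filter fun x : Fin n => (x : ℕ) < k)
      (omega1 (Gamma k hk A)) (omega1 A) := by
  obtain ⟨L, D, hLD⟩ := h.mem_leading.2
  obtain ⟨β, -, hβ₃, hβ₀, hβ₂⟩ := hLD.block_diag
  have heq : omega1 (leadingBlock A k hk) = L * D * Lᵀ := by
    simpa using hLD.eq
  have hrow : ∀ i, ∃ j, D i j ≠ 0 := by
    intro i
    by_contra! hi
    have h₁ : D.rank ≤ (Finset.univ.erase i).card := by
      apply rank_le_card_of_support_subset
      intro x hx
      simp only [Finset.coe_erase, Finset.coe_univ, Set.mem_sdiff, Set.mem_univ,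
        Set.mem_singleton_iff, true_and]
      rintro rfl
      exact hx (funext hi)
    have h₂ : k ≤ D.rank := by
      calc k = (L * D * Lᵀ).rank := by rw [← heq, h.rank_leading]
        _ ≤ (L * D).rank := rank_mul_le_left _ _
        _ ≤ D.rank := rank_mul_le_right _ _
    rw [Finset.card_erase_of_mem (Finset.mem_univ i), Finset.card_univ, Fintype.card_fin] at h₁
    have := i.2
    omega
  have := isPivotTransform_gaussJordanLoop hk hLD.unit_diag hLD.lower hLD.normalized hβ₃ hβ₀ hβ₂
    hrow 0 A (fun a b ha => absurd ha (Nat.not_lt_zero _)) (fun a b _ _ => by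
      rw [tailProduct_zero, ← heq]
      rfl)
  simpa [Gamma] using this

/-! ### Existence of a pivot ordering -/

/-- `A = L D Lᵀ` with pivot blocks, with no permutation. -/
def HasLDL {n : ℕ} (A : Matrix (Fin n) (Fin n) (ZMod 2)) : Prop :=
  ∃ L D, IsLDL A 1 L D

theorem hasLDL_iff {n : ℕ} {A : Matrix (Fin n) (Fin n) (ZMod 2)} :
    HasLDL A ↔ ∃ (L D : Matrix (Fin n) (Fin n) (ZMod 2)), A = L * D * Lᵀ ∧ (∀ i, L i i = 1) ∧
      (∀ i j, i < j → L i j = 0) ∧ IsPivotBlockDiagonal D ∧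
      ∀ i j : Fin n, (j : ℕ) = i + 1 →
        D i i = 0 → D i j = 1 → D j i = 1 → D j j = 0 → L j i = 0 := by
  constructor
  · rintro ⟨L, D, h⟩
    exact ⟨L, D, by simpa using h.eq, h.unit_diag, h.lower, h.block_diag, h.normalized⟩
  · rintro ⟨L, D, h₁, h₂, h₃, h₄, h₅⟩
    exact ⟨L, D, by simpa using h₁, h₂, h₃, h₄, h₅⟩

theorem hasLDL_zero {n : ℕ} : HasLDL (0 : Matrix (Fin n) (Fin n) (ZMod 2)) := by
  rw [hasLDL_iff]
  refine ⟨1, 0, by simp, by simp, fun i j h => one_apply_ne h.ne,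
    ⟨fun i => i, fun i j h => h, fun i j l h₁ h₂ => (Fin.lt_def.mp (h₁.trans h₂)).ne, by simp, ?_⟩,
    by simp⟩
  intro i j h₁ h₂
  exact absurd h₂ (Fin.lt_def.mp h₁).ne

/-- Prepending a `1 × 1` pivot to a decomposition of the Schur complement. -/
theorem HasLDL.cons_one {n : ℕ} {A : Matrix (Fin (n + 1)) (Fin (n + 1)) (ZMod 2)} (hA : A.IsSymm)
    (h₀ : A 0 0 = 1)
    (h : HasLDL (Matrix.of fun i j : Fin n => A i.succ j.succ + A i.succ 0 * A j.succ 0)) :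
    HasLDL A := by
  rw [hasLDL_iff] at h ⊢
  obtain ⟨L, D, hLD, hdiag, hlower, ⟨β, hβ, hβ₃, hβ₀, hβ₂⟩, hnorm⟩ := h
  have hS (i j : Fin n) : A i.succ j.succ = (L * D * Lᵀ) i j + A i.succ 0 * A j.succ 0 := by
    rw [← hLD, of_apply, add_assoc, CharTwo.add_self_eq_zero, add_zero]
  have hsymm (i : Fin n) : A 0 i.succ = A i.succ 0 := hA.apply _ _
  refine ⟨Matrix.of (Fin.cons (Fin.cons 1 0) fun i => Fin.cons (A i.succ 0) (L i)),
    Matrix.of (Fin.cons (Fin.cons 1 0) fun i => Fin.cons 0 (D i)), ?_, ?_, ?_, ?_, ?_⟩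
  · ext i j
    refine Fin.cases ?_ (fun i => ?_) i <;> refine Fin.cases ?_ (fun j => ?_) j <;>
      simp [mul_apply, Fin.sum_univ_succ, h₀, hS, hsymm, add_comm]
  · intro i
    refine Fin.cases ?_ (fun i => ?_) i <;> simp [hdiag]
  · intro i j
    refine Fin.cases ?_ (fun i => ?_) i <;> refine Fin.cases ?_ (fun j => ?_) j <;> simp
    exact hlower i j
  · refine ⟨Fin.cons 0 fun i => β i + 1, ?_, ?_, ?_, ?_⟩
    · intro i j
      refine Fin.cases ?_ (fun i => ?_) i <;> refine Fin.cases ?_ (fun j => ?_) j <;> simp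
      exact fun h => hβ h
    · intro i j l
      refine Fin.cases ?_ (fun i => ?_) i <;> refine Fin.cases ?_ (fun j => ?_) j <;>
        refine Fin.cases ?_ (fun l => ?_) l <;> simp
      exact hβ₃ i j l
    · intro i j
      refine Fin.cases ?_ (fun i => ?_) i <;> refine Fin.cases ?_ (fun j => ?_) j <;> simp
      exact hβ₀ i j
    · intro i j
      refine Fin.cases ?_ (fun i => ?_) i <;> refine Fin.cases ?_ (fun j => ?_) j <;> simp
      exact hβ₂ i j
  · intro i j
    refine Fin.cases ?_ (fun i => ?_) i <;> refine Fin.cases ?_ (fun j => ?_) j <;> simp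
    exact hnorm i j

/-- Prepending a `2 × 2` pivot to a decomposition of the Schur complement. -/
theorem HasLDL.cons_two {n : ℕ} {A : Matrix (Fin (n + 2)) (Fin (n + 2)) (ZMod 2)} (hA : A.IsSymm)
    (h₀ : A 0 0 = 0) (h₁ : A 0 1 = 1) (h₂ : A 1 1 = 0)
    (h : HasLDL (Matrix.of fun i j : Fin n => A i.succ.succ j.succ.succ +
      (A i.succ.succ 0 * A j.succ.succ 1 + A i.succ.succ 1 * A j.succ.succ 0))) :
    HasLDL A := by
  rw [hasLDL_iff] at h ⊢
  obtain ⟨L, D, hLD, hdiag, hlower, ⟨β, hβ, hβ₃, hβ₀, hβ₂⟩, hnorm⟩ := h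
  have hS (i j : Fin n) : A i.succ.succ j.succ.succ = (L * D * Lᵀ) i j +
      (A i.succ.succ 0 * A j.succ.succ 1 + A i.succ.succ 1 * A j.succ.succ 0) := by
    rw [← hLD, of_apply, add_assoc, CharTwo.add_self_eq_zero, add_zero]
  have hsymm₀ (i : Fin n) : A 0 i.succ.succ = A i.succ.succ 0 := hA.apply _ _
  have hsymm₁ (i : Fin n) : A 1 i.succ.succ = A i.succ.succ 1 := hA.apply _ _
  have h₁' : A 1 0 = 1 := (hA.apply _ _).trans h₁
  -- The block `[0 1; 1 0]` exchanges the two columns, hence the order of the entries in `L`.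
  refine ⟨Matrix.of (Fin.cons (Fin.cons 1 (Fin.cons 0 0)) (Fin.cons (Fin.cons 0 (Fin.cons 1 0))
      fun i => Fin.cons (A i.succ.succ 1) (Fin.cons (A i.succ.succ 0) (L i)))),
    Matrix.of (Fin.cons (Fin.cons 0 (Fin.cons 1 0)) (Fin.cons (Fin.cons 1 (Fin.cons 0 0))
      fun i => Fin.cons 0 (Fin.cons 0 (D i)))), ?_, ?_, ?_, ?_, ?_⟩
  · ext i j
    refine Fin.cases ?_ (fun i => Fin.cases ?_ (fun i => ?_) i) i <;>
      refine Fin.cases ?_ (fun j => Fin.cases ?_ (fun j => ?_) j) j <;>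
      simp [mul_apply, Fin.sum_univ_succ, h₀, h₁, h₁', h₂, hS, hsymm₀, hsymm₁]
    ring
  · intro i
    refine Fin.cases ?_ (fun i => Fin.cases ?_ (fun i => ?_) i) i <;> simp [hdiag]
  · intro i j
    refine Fin.cases ?_ (fun i => Fin.cases ?_ (fun i => ?_) i) i <;>
      refine Fin.cases ?_ (fun j => Fin.cases ?_ (fun j => ?_) j) j <;> simp
    exact hlower i j
  · refine ⟨Fin.cons 0 (Fin.cons 0 fun i => β i + 1), ?_, ?_, ?_, ?_⟩
    · intro i j
      refine Fin.cases ?_ (fun i => Fin.cases ?_ (fun i => ?_) i) i <;>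
        refine Fin.cases ?_ (fun j => Fin.cases ?_ (fun j => ?_) j) j <;> simp
      · exact Fin.lt_def.mpr (by simp)
      · exact fun h => hβ h
    · intro i j l
      refine Fin.cases ?_ (fun i => Fin.cases ?_ (fun i => ?_) i) i <;>
        refine Fin.cases ?_ (fun j => Fin.cases ?_ (fun j => ?_) j) j <;>
        refine Fin.cases ?_ (fun l => Fin.cases ?_ (fun l => ?_) l) l <;> simp
      exact hβ₃ i j l
    · intro i j
      refine Fin.cases ?_ (fun i => Fin.cases ?_ (fun i => ?_) i) i <;>
        refine Fin.cases ?_ (fun j => Fin.cases ?_ (fun j => ?_) j) j <;> simp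
      exact hβ₀ i j
    · intro i j
      refine Fin.cases ?_ (fun i => Fin.cases ?_ (fun i => ?_) i) i <;>
        refine Fin.cases ?_ (fun j => Fin.cases ?_ (fun j => ?_) j) j <;> simp
      exact hβ₂ i j
  · intro i j
    refine Fin.cases ?_ (fun i => Fin.cases ?_ (fun i => ?_) i) i <;>
      refine Fin.cases ?_ (fun j => Fin.cases ?_ (fun j => ?_) j) j <;> simp
    exact hnorm i j

/-- The enumeration of `ι` that starts with `i` and continues with an enumeration of the rest. -/
def consEquiv {ι : Type} [DecidableEq ι] {m : ℕ} (i : ι) (e : Fin m ≃ {x // x ≠ i}) :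
    Fin (m + 1) ≃ ι :=
  (finSuccEquiv m).trans ((Equiv.optionCongr e).trans (Equiv.optionSubtypeNe i))

@[simp] theorem consEquiv_zero {ι : Type} [DecidableEq ι] {m : ℕ} (i : ι)
    (e : Fin m ≃ {x // x ≠ i}) : consEquiv i e 0 = i := by
  simp [consEquiv]

@[simp] theorem consEquiv_succ {ι : Type} [DecidableEq ι] {m : ℕ} (i : ι)
    (e : Fin m ≃ {x // x ≠ i}) (j : Fin m) : consEquiv i e j.succ = e j := by
  simp [consEquiv]

/-- The block of `M` on `K` is nonsingular: it kills no nonzero vector. -/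
def NonsingularOn {ι : Type} [Fintype ι] (K : Finset ι) (M : Matrix ι ι (ZMod 2)) : Prop :=
  ∀ r : ι → ZMod 2, (∀ x ∉ K, r x = 0) → (∀ x ∈ K, (M *ᵥ r) x = 0) → r = 0

/-- Eliminating a `1 × 1` pivot `i` keeps the rest of a nonsingular block nonsingular: a vector
killed by the Schur complement extends uniquely to a vector killed by the block. Here `f` is the
inclusion of the indices other than `i`. -/
theorem NonsingularOn.schur_one {ι κ : Type} [Fintype ι] [DecidableEq ι] [Fintype κ] {K : Finset ι}
    {M : Matrix ι ι (ZMod 2)} (h : NonsingularOn K M) (hM : M.IsSymm) {i : ι} (hi : M i i = 1)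
    (hiK : K.Nonempty → i ∈ K) (f : κ → ι) (hf : f.Injective) (hfi : ∀ x, f x ≠ i)
    (hsurj : ∀ y, y ≠ i → ∃ x, f x = y)
    (hsum : ∀ g : ι → ZMod 2, ∑ y, g y = g i + ∑ x, g (f x)) {K' : Finset κ}
    (hK' : ∀ x, x ∈ K' ↔ f x ∈ K) :
    NonsingularOn K' (Matrix.of fun a b => M (f a) (f b) + M (f a) i * M (f b) i) := by
  intro r hr hS
  set E : ι → ZMod 2 := Function.update (Function.extend f r 0) i (∑ x, M i (f x) * r x) with hE
  have hEi : E i = ∑ x, M i (f x) * r x := by simp [hE]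
  have hEf (x : κ) : E (f x) = r x := by simp [hE, hfi x, hf.extend_apply]
  suffices hE₀ : E = 0 by
    ext x
    rw [← hEf x, hE₀]
    rfl
  refine h E (fun y hy => ?_) fun y hy => ?_
  · by_cases hyi : y = i
    · subst hyi
      have hKe : K = ∅ := by
        by_contra hne
        exact hy (hiK (Finset.nonempty_iff_ne_empty.mpr hne))
      rw [hEi]
      exact Finset.sum_eq_zero fun x _ => by rw [hr x (by simp [hK', hKe]), mul_zero]
    · obtain ⟨x, rfl⟩ := hsurj y hyi
      rw [hEf]
      exact hr x (by rwa [hK'])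
  · simp only [mulVec, dotProduct, hsum, hEi, hEf]
    by_cases hyi : y = i
    · subst hyi
      rw [hi, one_mul]
      exact CharTwo.add_self_eq_zero _
    · obtain ⟨x, rfl⟩ := hsurj y hyi
      rw [← hS x ((hK' x).mpr hy)]
      simp only [mulVec, dotProduct, of_apply, add_mul, Finset.sum_add_distrib, Finset.mul_sum]
      rw [add_comm]
      congr 1
      exact Finset.sum_congr rfl fun z _ => by rw [hM.apply (f z) i]; ring

/-- Eliminating a `2 × 2` pivot `i, j` keeps the rest of a nonsingular block nonsingular. Here `f`
is the inclusion of the other indices. -/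
theorem NonsingularOn.schur_two {ι κ : Type} [Fintype ι] [DecidableEq ι] [Fintype κ] {K : Finset ι}
    {M : Matrix ι ι (ZMod 2)} (h : NonsingularOn K M) (hM : M.IsSymm) {i j : ι} (hij : i ≠ j)
    (hi : M i i = 0) (hMij : M i j = 1) (hj : M j j = 0) (hijK : K.Nonempty → i ∈ K ∧ j ∈ K)
    (f : κ → ι) (hf : f.Injective) (hfi : ∀ x, f x ≠ i) (hfj : ∀ x, f x ≠ j)
    (hsurj : ∀ y, y ≠ i → y ≠ j → ∃ x, f x = y)
    (hsum : ∀ g : ι → ZMod 2, ∑ y, g y = g i + (g j + ∑ x, g (f x))) {K' : Finset κ}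
    (hK' : ∀ x, x ∈ K' ↔ f x ∈ K) :
    NonsingularOn K' (Matrix.of fun a b =>
      M (f a) (f b) + (M (f a) i * M (f b) j + M (f a) j * M (f b) i)) := by
  intro r hr hS
  have hMji : M j i = 1 := (hM.apply _ _).trans hMij
  -- The block `[0 1; 1 0]` on `i, j` makes row `j` determine `E i` and row `i` determine `E j`.
  set E : ι → ZMod 2 := Function.update (Function.update (Function.extend f r 0)
    j (∑ x, M i (f x) * r x)) i (∑ x, M j (f x) * r x) with hE
  have hEi : E i = ∑ x, M j (f x) * r x := by simp [hE]
  have hEj : E j = ∑ x, M i (f x) * r x := by simp [hE, hij.symm]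
  have hEf (x : κ) : E (f x) = r x := by simp [hE, hfi x, hfj x, hf.extend_apply]
  suffices hE₀ : E = 0 by
    ext x
    rw [← hEf x, hE₀]
    rfl
  have hr₀ (hKe : K = ∅) (x : κ) : r x = 0 := hr x (by simp [hK', hKe])
  refine h E (fun y hy => ?_) fun y hy => ?_
  · by_cases hyi : y = i
    · subst hyi
      have hKe : K = ∅ := by
        by_contra hne
        exact hy (hijK (Finset.nonempty_iff_ne_empty.mpr hne)).1
      rw [hEi]
      exact Finset.sum_eq_zero fun x _ => by rw [hr₀ hKe, mul_zero]
    · by_cases hyj : y = j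
      · subst hyj
        have hKe : K = ∅ := by
          by_contra hne
          exact hy (hijK (Finset.nonempty_iff_ne_empty.mpr hne)).2
        rw [hEj]
        exact Finset.sum_eq_zero fun x _ => by rw [hr₀ hKe, mul_zero]
      · obtain ⟨x, rfl⟩ := hsurj y hyi hyj
        rw [hEf]
        exact hr x (by rwa [hK'])
  · simp only [mulVec, dotProduct, hsum, hEi, hEj, hEf]
    by_cases hyi : y = i
    · rw [hyi, hi, hMij, zero_mul, one_mul, zero_add]
      exact CharTwo.add_self_eq_zero _
    · by_cases hyj : y = j
      · rw [hyj, hj, hMji, zero_mul, one_mul, zero_add]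
        exact CharTwo.add_self_eq_zero _
      · obtain ⟨x, rfl⟩ := hsurj y hyi hyj
        rw [← hS x ((hK' x).mpr hy)]
        simp only [mulVec, dotProduct, of_apply, add_mul, Finset.sum_add_distrib, Finset.mul_sum]
        rw [← add_assoc, add_comm]
        congr 1
        congr 1
        · exact Finset.sum_congr rfl fun z _ => by rw [hM.apply (f z) j]; ring
        · exact Finset.sum_congr rfl fun z _ => by rw [hM.apply (f z) i]; ring

/-- A nonzero matrix over `𝔽₂` has a diagonal entry `1` or, between two zero diagonal entries, an
off-diagonal entry `1`. These can be found inside `K` when the block on `K` is nonsingular. -/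
theorem exists_pivot {ι : Type} [Fintype ι] [DecidableEq ι] {K : Finset ι}
    {M : Matrix ι ι (ZMod 2)} (h : NonsingularOn K M) (h₀ : M ≠ 0) :
    (∃ i, M i i = 1 ∧ (K.Nonempty → i ∈ K)) ∨
      ∃ i j, i ≠ j ∧ M i i = 0 ∧ M i j = 1 ∧ M j j = 0 ∧ (K.Nonempty → i ∈ K ∧ j ∈ K) := by
  have hone (x : ZMod 2) (hx : x ≠ 0) : x = 1 := by
    revert x
    decide
  have key : ∃ i j, M i j ≠ 0 ∧ (K.Nonempty → i ∈ K ∧ j ∈ K) := by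
    rcases K.eq_empty_or_nonempty with rfl | ⟨x, hx⟩
    · by_contra! hall
      exact h₀ (Matrix.ext fun i j => by
        by_contra hij
        exact absurd (hall i j hij).1 (by simp))
    · by_contra! hall
      have hr : (Pi.single x 1 : ι → ZMod 2) = 0 := by
        refine h _ (fun y hy => ?_) fun y hy => ?_
        · rw [Pi.single_eq_of_ne]
          rintro rfl
          exact hy hx
        · rw [mulVec_single_one]
          by_contra hyx
          exact (hall y x hyx).2 hy hx
      simpa using congrFun hr x
  obtain ⟨i, j, hij, hK⟩ := key
  by_cases hi : M i i = 0
  · by_cases hj : M j j = 0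
    · refine Or.inr ⟨i, j, ?_, hi, hone _ hij, hj, hK⟩
      rintro rfl
      exact hij hi
    · exact Or.inl ⟨j, hone _ hj, fun h => (hK h).2⟩
  · exact Or.inl ⟨i, hone _ hi, fun h => (hK h).1⟩

/-- Every symmetric matrix over `𝔽₂` has an LDL decomposition after a suitable reordering, and a
set `K` carrying a nonsingular block can be placed first. -/
theorem exists_hasLDL_submatrix (m : ℕ) : ∀ (ι : Type) [Fintype ι] [DecidableEq ι],
    Fintype.card ι = m → ∀ (K : Finset ι) (M : Matrix ι ι (ZMod 2)), M.IsSymm →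
      NonsingularOn K M → ∃ e : Fin m ≃ ι, (∀ j, e j ∈ K ↔ (j : ℕ) < K.card) ∧
        HasLDL (M.submatrix e e) := by
  induction m using Nat.strong_induction_on with
  | _ m IH =>
  intro ι _ _ hcard K M hM hK
  by_cases h₀ : M = 0
  · have hKe : K = ∅ := by
      by_contra hne
      obtain ⟨x, hx⟩ := Finset.nonempty_iff_ne_empty.mpr hne
      have hr : (Pi.single x 1 : ι → ZMod 2) = 0 := by
        refine hK _ (fun y hy => ?_) fun y _ => by simp [h₀]
        rw [Pi.single_eq_of_ne]
        rintro rfl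
        exact hy hx
      simpa using congrFun hr x
    refine ⟨(Fintype.equivFinOfCardEq hcard).symm, by simp [hKe], ?_⟩
    rw [h₀, submatrix_zero]
    exact hasLDL_zero
  rcases exists_pivot hK h₀ with ⟨i, hi, hiK⟩ | ⟨i, j, hij, hi, hMij, hj, hijK⟩
  · have hsum (f : ι → ZMod 2) : ∑ x, f x = f i + ∑ x : {x // x ≠ i}, f x :=
      Fintype.sum_eq_add_sum_subtype_ne f i
    obtain ⟨m, rfl⟩ : ∃ l, m = l + 1 :=
      Nat.exists_eq_succ_of_ne_zero (hcard ▸ (Fintype.card_pos_iff.mpr ⟨i⟩).ne')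
    set S : Matrix {x // x ≠ i} {x // x ≠ i} (ZMod 2) :=
      Matrix.of fun a b => M a b + M a i * M b i with hS
    obtain ⟨e, he, hLDL⟩ := IH m (Nat.lt_succ_self m) {x // x ≠ i}
      (by rw [Fintype.card_subtype_compl, hcard]; simp) (K.subtype _) S
      (by
        ext a b
        simp only [hS, transpose_apply, of_apply, hM.apply a b]
        ring)
      (hK.schur_one hM hi hiK Subtype.val Subtype.val_injective (fun x => x.2)
        (fun y hy => ⟨⟨y, hy⟩, rfl⟩) hsum (by simp))
    refine ⟨consEquiv i e, fun j => ?_, HasLDL.cons_one ?_ ?_ ?_⟩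
    · rcases K.eq_empty_or_nonempty with rfl | hne
      · simp
      · have hcardK : (K.subtype (· ≠ i)).card + 1 = K.card := by
          rw [Finset.card_subtype, Finset.filter_ne', Finset.card_erase_add_one (hiK hne)]
        refine Fin.cases ?_ (fun j => ?_) j
        · simp [hiK hne, hne.card_pos]
        · have := he j
          rw [Finset.mem_subtype] at this
          rw [consEquiv_succ, this, Fin.val_succ]
          omega
    · exact hM.submatrix _
    · simpa using hi
    · convert hLDL using 1
      ext a b
      simp [hS]
  · have hji : j ≠ i := hij.symm
    have hsum (f : ι → ZMod 2) :
        ∑ x, f x = f i + (f j + ∑ x : {x : {x // x ≠ i} // x ≠ ⟨j, hji⟩}, f x) := by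
      rw [Fintype.sum_eq_add_sum_subtype_ne f i,
        Fintype.sum_eq_add_sum_subtype_ne (fun x : {x // x ≠ i} => f x) ⟨j, hji⟩]
    have hc₁ : Fintype.card {x // x ≠ i} = m - 1 := by
      rw [Fintype.card_subtype_compl, hcard]; simp
    have hc₂ : Fintype.card {x : {x // x ≠ i} // x ≠ ⟨j, hji⟩} = m - 2 := by
      rw [Fintype.card_subtype_compl, hc₁]; simp; omega
    have hm₀ : 0 < m - 1 := hc₁ ▸ Fintype.card_pos_iff.mpr ⟨⟨j, hji⟩⟩
    obtain ⟨m, rfl⟩ : ∃ l, m = l + 2 := ⟨m - 2, by omega⟩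
    set κ := {x : {x // x ≠ i} // x ≠ ⟨j, hji⟩}
    set f : κ → ι := fun x => x with hf
    have hfi (x : κ) : f x ≠ i := x.1.2
    have hfj (x : κ) : f x ≠ j := fun h => x.2 (Subtype.ext h)
    set S : Matrix κ κ (ZMod 2) :=
      Matrix.of fun a b => M (f a) (f b) + (M (f a) i * M (f b) j + M (f a) j * M (f b) i) with hS
    set K' : Finset κ := (K.subtype (· ≠ i)).subtype (· ≠ ⟨j, hji⟩) with hK'
    have hmemK' (x : κ) : x ∈ K' ↔ f x ∈ K := by
      rw [hK', Finset.mem_subtype, Finset.mem_subtype]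
    obtain ⟨e, he, hLDL⟩ := IH m (by omega) κ hc₂ K' S
      (by
        ext a b
        simp only [hS, transpose_apply, of_apply, hM.apply (f a) (f b)]
        ring)
      (hK.schur_two hM hij hi hMij hj hijK f
        (Subtype.val_injective.comp Subtype.val_injective) hfi hfj
        (fun y hyi hyj => ⟨⟨⟨y, hyi⟩, fun h => hyj (congrArg Subtype.val h)⟩, rfl⟩) hsum hmemK')
    have hone : consEquiv i (consEquiv ⟨j, hji⟩ e) 1 = j := by
      rw [show (1 : Fin (m + 2)) = Fin.succ 0 from rfl, consEquiv_succ, consEquiv_zero]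
    refine ⟨consEquiv i (consEquiv ⟨j, hji⟩ e), fun l => ?_, HasLDL.cons_two ?_ ?_ ?_ ?_ ?_⟩
    · rcases K.eq_empty_or_nonempty with rfl | hne
      · simp
      · have hcardK : K'.card + 2 = K.card := by
          have hj' : (⟨j, hji⟩ : {x // x ≠ i}) ∈ K.subtype (· ≠ i) := by
            simpa using (hijK hne).2
          have h₁ : (K.subtype (· ≠ i)).card + 1 = K.card := by
            rw [Finset.card_subtype, Finset.filter_ne', Finset.card_erase_add_one (hijK hne).1]
          have h₂ : K'.card + 1 = (K.subtype (· ≠ i)).card := by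
            rw [hK', Finset.card_subtype, Finset.filter_ne', Finset.card_erase_add_one hj']
          omega
        refine Fin.cases ?_ (fun l => Fin.cases ?_ (fun l => ?_) l) l
        · simp [(hijK hne).1, hne.card_pos]
        · rw [consEquiv_succ, consEquiv_zero]
          simp only [(hijK hne).2, true_iff]
          simp
          omega
        · have := (hmemK' (e l)).symm.trans (he l)
          rw [consEquiv_succ, consEquiv_succ, this, Fin.val_succ, Fin.val_succ]
          omega
    · exact hM.submatrix _
    · simpa using hi
    · simpa [hone] using hMij
    · simpa [hone] using hj
    · convert hLDL using 1
      ext a b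
      simp [hone, hS, hf]

/-! ### Amplitudes of graph states -/

theorem zmod_two_cases (a : ZMod 2) : a = 0 ∨ a = 1 := by
  revert a
  decide

/-- The sign `(-1)^a`. -/
noncomputable def sgn (a : ZMod 2) : ℂ := if a = 0 then 1 else -1

@[simp] theorem sgn_zero : sgn 0 = 1 := by simp [sgn]

@[simp] theorem sgn_one : sgn 1 = -1 := by simp [sgn]

theorem sgn_add (a b : ZMod 2) : sgn (a + b) = sgn a * sgn b := by
  rcases zmod_two_cases a with rfl | rfl <;> rcases zmod_two_cases b with rfl | rfl <;>
    simp [show (1 + 1 : ZMod 2) = 0 from rfl]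

theorem sgn_sum {α : Type*} (s : Finset α) (f : α → ZMod 2) :
    sgn (∑ x ∈ s, f x) = ∏ x ∈ s, sgn (f x) := by
  classical
  induction s using Finset.induction_on with
  | empty => simp
  | insert a s ha ih => rw [Finset.sum_insert ha, Finset.prod_insert ha, sgn_add, ih]

theorem sgn_mul_self (a : ZMod 2) : sgn a * sgn a = 1 := by
  rw [← sgn_add, CharTwo.add_self_eq_zero, sgn_zero]

theorem sgn_ne_zero (a : ZMod 2) : sgn a ≠ 0 := by
  unfold sgn
  split_ifs <;> norm_num

theorem sgn_injective : Function.Injective sgn := by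
  intro a b
  rcases zmod_two_cases a with rfl | rfl <;> rcases zmod_two_cases b with rfl | rfl <;>
    norm_num [sgn]

/-- The identification of the elements of `𝔽₂` with the labels of the basis vectors of a qubit. -/
def digit : ZMod 2 ≃ Fin 2 := Equiv.refl (Fin 2)

@[simp] theorem digit_zero : digit 0 = 0 := rfl

@[simp] theorem digit_one : digit 1 = 1 := rfl

@[simp] theorem digit_symm_zero : digit.symm 0 = 0 := rfl

@[simp] theorem digit_symm_one : digit.symm 1 = 1 := rfl

/-- The amplitude of `ψ` at the basis vector `|x⟩`, for a bit string `x` with entries in `𝔽₂`. -/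
def amplitude {n : ℕ} (ψ : QState n) (x : Fin n → ZMod 2) : ℂ := ψ fun i => digit (x i)

theorem amplitude_ext {n : ℕ} {ψ φ : QState n} (h : ∀ x, amplitude ψ x = amplitude φ x) :
    ψ = φ := by
  funext y
  simpa [amplitude] using h fun i => digit.symm (y i)

theorem amplitude_smul {n : ℕ} (c : ℂ) (ψ : QState n) (x : Fin n → ZMod 2) :
    amplitude (c • ψ) x = c * amplitude ψ x := rfl

theorem sum_digit {n : ℕ} (f : (Fin n → Fin 2) → ℂ) :
    ∑ y, f y = ∑ x : Fin n → ZMod 2, f fun i => digit (x i) :=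
  (Equiv.sum_comp (Equiv.piCongrRight fun _ : Fin n => digit) f).symm

open Classical in
/-- The sign with which the basis vector `|x⟩` occurs in the graph state of `G`: minus one to the
number of edges of `G` inside the support of `x`. -/
noncomputable def graphSign {n : ℕ} (G : SimpleGraph (Fin n)) [DecidableRel G.Adj]
    (x : Fin n → ZMod 2) : ℂ :=
  ∏ e ∈ G.edgeFinset, if ∀ i ∈ e, x i = 1 then -1 else 1

theorem amplitude_graphState {n : ℕ} (G : SimpleGraph (Fin n)) [DecidableRel G.Adj]
    (x : Fin n → ZMod 2) :
    amplitude (graphState G) x = graphSign G x * (1 / (Real.sqrt 2 : ℂ)) ^ n := by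
  classical
  have hdiag : (G.edgeFinset.noncommProd czGate fun e _ f _ _ => czGate_commute e f) =
      diagonal fun y : Fin n → Fin 2 => graphSign G fun i => digit.symm (y i) := by
    have h := Finset.map_noncommProd (β := (Fin n → Fin 2) → ℂ) G.edgeFinset
      (fun e x => if ∀ i ∈ e, x i = 1 then (-1 : ℂ) else 1) (fun _ _ _ _ _ => Commute.all _ _)
      (diagonalRingHom (Fin n → Fin 2) ℂ)
    rw [Finset.noncommProd_eq_prod] at h
    simp only [diagonalRingHom_apply] at h
    unfold czGate
    convert h.symm using 1
    congr 1
    funext x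
    simp only [Finset.prod_apply, graphSign]
    refine Finset.prod_congr rfl fun e _ => ?_
    congr
  unfold graphState amplitude
  rw [hdiag, mulVec_diagonal]
  simp only [Equiv.symm_apply_apply]
  congr 1
  unfold plusState
  rw [Finset.prod_congr rfl (g := fun _ => 1 / (Real.sqrt 2 : ℂ))]
  · simp
  · intro i _
    rcases zmod_two_cases (x i) with h | h <;> simp [h]

theorem graphSign_eq_sgn {n : ℕ} (x : Fin n → ZMod 2) (a b : Fin n)
    [Decidable (∀ i ∈ s(a, b), x i = 1)] :
    (if ∀ i ∈ s(a, b), x i = 1 then (-1 : ℂ) else 1) = sgn (x a * x b) := by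
  have h : (∀ i ∈ s(a, b), x i = 1) ↔ x a = 1 ∧ x b = 1 := by simp
  rw [if_congr h rfl rfl]
  rcases zmod_two_cases (x a) with ha | ha <;> rcases zmod_two_cases (x b) with hb | hb <;>
    simp [ha, hb]

/-- The polarization of the quadratic form counting edges is the adjacency matrix. -/
theorem graphSign_add {n : ℕ} (G : SimpleGraph (Fin n)) [DecidableRel G.Adj]
    (x r : Fin n → ZMod 2) : graphSign G (x + r) =
      graphSign G x * graphSign G r * sgn (x ⬝ᵥ G.adjMatrix (ZMod 2) *ᵥ r) := by
  classical
  have hpol : x ⬝ᵥ G.adjMatrix (ZMod 2) *ᵥ r =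
      ∑ e ∈ G.edgeFinset, ∑ i, ∑ j, if s(i, j) = e then x i * r j else 0 := by
    rw [Finset.sum_comm]
    simp only [dotProduct, mulVec, Finset.mul_sum]
    refine Finset.sum_congr rfl fun i _ => ?_
    rw [Finset.sum_comm]
    refine Finset.sum_congr rfl fun j _ => ?_
    rw [Finset.sum_ite_eq]
    simp [SimpleGraph.adjMatrix_apply]
  rw [hpol, sgn_sum]
  unfold graphSign
  rw [← Finset.prod_mul_distrib, ← Finset.prod_mul_distrib]
  refine Finset.prod_congr rfl fun e he => ?_
  induction e with
  | _ a b =>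
  have hab : a ≠ b := (SimpleGraph.mem_edgeFinset.mp he).ne
  have hedge : ∑ i, ∑ j, (if s(i, j) = s(a, b) then x i * r j else 0) =
      x a * r b + x b * r a := by
    have hsplit (i j : Fin n) : (if s(i, j) = s(a, b) then x i * r j else 0) =
        (if i = a then if j = b then x i * r j else 0 else 0) +
          if i = b then if j = a then x i * r j else 0 else 0 := by
      simp only [Sym2.eq_iff]
      by_cases hia : i = a
      · subst hia
        simp [hab]
      · by_cases hib : i = b
        · subst hib
          simp [hia]
        · simp [hia, hib]
    simp only [hsplit, Finset.sum_add_distrib]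
    simp
  rw [hedge, graphSign_eq_sgn, graphSign_eq_sgn, graphSign_eq_sgn, ← sgn_add, ← sgn_add]
  congr 1
  simp only [Pi.add_apply]
  ring

theorem graphSign_zero {n : ℕ} (G : SimpleGraph (Fin n)) [DecidableRel G.Adj] :
    graphSign G 0 = 1 := by
  refine Finset.prod_eq_one fun e _ => ?_
  induction e with
  | _ a b => rw [graphSign_eq_sgn]; simp

theorem norm_graphSign {n : ℕ} (G : SimpleGraph (Fin n)) [DecidableRel G.Adj]
    (x : Fin n → ZMod 2) : ‖graphSign G x‖ = 1 := by
  rw [graphSign, norm_prod]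
  refine Finset.prod_eq_one fun e _ => ?_
  split_ifs <;> simp

theorem graphSign_ne_zero {n : ℕ} (G : SimpleGraph (Fin n)) [DecidableRel G.Adj]
    (x : Fin n → ZMod 2) : graphSign G x ≠ 0 := by
  rw [← norm_ne_zero_iff, norm_graphSign]
  exact one_ne_zero

theorem inv_sqrt_two_pow_ne_zero (n : ℕ) : (1 / (Real.sqrt 2 : ℂ)) ^ n ≠ 0 := by
  apply pow_ne_zero
  rw [one_div]
  exact inv_ne_zero (Complex.ofReal_ne_zero.mpr (by positivity))

/-! ### Pauli operators and Clifford unitaries -/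

theorem tensorOp_mul {n : ℕ} (U V : Fin n → Matrix (Fin 2) (Fin 2) ℂ) :
    tensorOp U * tensorOp V = tensorOp fun i => U i * V i := by
  ext x z
  simp only [tensorOp, mul_apply, of_apply, ← Finset.prod_mul_distrib]
  rw [Finset.prod_univ_sum, Fintype.piFinset_univ]

theorem tensorOp_smul {n : ℕ} (c : Fin n → ℂ) (U : Fin n → Matrix (Fin 2) (Fin 2) ℂ) :
    tensorOp (fun i => c i • U i) = (∏ i, c i) • tensorOp U := by
  ext x z
  simp [tensorOp, Finset.prod_mul_distrib]

theorem tensorOp_one {n : ℕ} : tensorOp (fun _ : Fin n => 1) = 1 := by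
  ext x z
  simp only [tensorOp, of_apply, one_apply, Finset.prod_ite_zero, Finset.prod_const_one,
    funext_iff, Finset.mem_univ, true_implies]

theorem tensorOp_conjTranspose {n : ℕ} (U : Fin n → Matrix (Fin 2) (Fin 2) ℂ) :
    (tensorOp U)ᴴ = tensorOp fun i => (U i)ᴴ := by
  ext x z
  simp [tensorOp]

/-- The one-qubit Pauli operator `Zˢ Xʳ`. -/
noncomputable def pauliOne (r s : ZMod 2) : Matrix (Fin 2) (Fin 2) ℂ :=
  Matrix.of fun x y => if digit.symm y = digit.symm x + r then sgn (s * digit.symm x) else 0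

/-- `ψ` is an eigenvector of the Pauli operator `Zˢ Xʳ`. -/
def IsPauliEigenvector {n : ℕ} (ψ : QState n) (r s : Fin n → ZMod 2) : Prop :=
  ∃ c : ℂ, (tensorOp fun i => pauliOne (r i) (s i)) *ᵥ ψ = c • ψ

theorem amplitude_tensorOp_pauliOne {n : ℕ} (ψ : QState n) (r s x : Fin n → ZMod 2) :
    amplitude ((tensorOp fun i => pauliOne (r i) (s i)) *ᵥ ψ) x =
      sgn (s ⬝ᵥ x) * amplitude ψ (x + r) := by
  have h (y : Fin n → ZMod 2) : (tensorOp fun i => pauliOne (r i) (s i)) (fun i => digit (x i))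
      (fun i => digit (y i)) = if y = x + r then sgn (s ⬝ᵥ x) else 0 := by
    simp only [tensorOp, pauliOne, of_apply, Equiv.symm_apply_apply, Finset.prod_ite_zero,
      dotProduct, sgn_sum, funext_iff, Finset.mem_univ, true_implies, Pi.add_apply]
  simp only [amplitude, mulVec, dotProduct, sum_digit, h, ite_mul, zero_mul, Finset.sum_ite_eq',
    Finset.mem_univ, if_true]

theorem isPauliEigenvector_iff {n : ℕ} {ψ : QState n} {r s : Fin n → ZMod 2} :
    IsPauliEigenvector ψ r s ↔
      ∃ c : ℂ, ∀ x, sgn (s ⬝ᵥ x) * amplitude ψ (x + r) = c * amplitude ψ x := by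
  refine exists_congr fun c => ?_
  constructor
  · intro h x
    rw [← amplitude_tensorOp_pauliOne, h, amplitude_smul]
  · intro h
    exact amplitude_ext fun x => (amplitude_tensorOp_pauliOne ψ r s x).trans (h x)

/-- The Pauli operators that have the graph state as an eigenvector are, up to phases, its
stabilizers `Z^{A r} X^r`. -/
theorem isPauliEigenvector_graphState {n : ℕ} (G : SimpleGraph (Fin n)) [DecidableRel G.Adj]
    (r s : Fin n → ZMod 2) :
    IsPauliEigenvector (graphState G) r s ↔ s = G.adjMatrix (ZMod 2) *ᵥ r := by
  rw [isPauliEigenvector_iff]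
  have hx (x : Fin n → ZMod 2) : sgn (s ⬝ᵥ x) * amplitude (graphState G) (x + r) =
      sgn (x ⬝ᵥ (s + G.adjMatrix (ZMod 2) *ᵥ r)) * graphSign G r * amplitude (graphState G) x := by
    rw [amplitude_graphState, amplitude_graphState, graphSign_add, dotProduct_add, sgn_add,
      dotProduct_comm s x]
    ring
  constructor
  · rintro ⟨c, hc⟩
    have hne (x : Fin n → ZMod 2) : amplitude (graphState G) x ≠ 0 := by
      rw [amplitude_graphState]
      exact mul_ne_zero (graphSign_ne_zero G x) (inv_sqrt_two_pow_ne_zero n)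
    have hc' (x : Fin n → ZMod 2) :
        sgn (x ⬝ᵥ (s + G.adjMatrix (ZMod 2) *ᵥ r)) * graphSign G r = c :=
      mul_right_cancel₀ (hne x) ((hx x).symm.trans (hc x))
    have h₁ (x : Fin n → ZMod 2) : x ⬝ᵥ (s + G.adjMatrix (ZMod 2) *ᵥ r) = 0 := by
      apply sgn_injective
      apply mul_right_cancel₀ (graphSign_ne_zero G r)
      rw [hc' x, ← hc' 0, zero_dotProduct]
    ext i
    have := h₁ (Pi.single i 1)
    rw [single_one_dotProduct, Pi.add_apply] at this
    exact CharTwo.add_eq_zero.mp this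
  · rintro rfl
    refine ⟨graphSign G r, fun x => ?_⟩
    rw [hx]
    have : G.adjMatrix (ZMod 2) *ᵥ r + G.adjMatrix (ZMod 2) *ᵥ r = 0 :=
      funext fun i => CharTwo.add_self_eq_zero _
    rw [this, dotProduct_zero, sgn_zero, one_mul]

/-- Conjugation by `U` acts on Pauli operators, up to phases, as `F` acts on exponents. -/
def Intertwines (U : Matrix (Fin 2) (Fin 2) ℂ) (F : ZMod 2 × ZMod 2 → ZMod 2 × ZMod 2) : Prop :=
  ∀ p : ZMod 2 × ZMod 2, ∃ c : ℂ, c ≠ 0 ∧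
    pauliOne (F p).1 (F p).2 * U = c • (U * pauliOne p.1 p.2)

theorem Intertwines.one : Intertwines 1 id := fun p => ⟨1, one_ne_zero, by simp⟩

theorem Intertwines.mul {U V : Matrix (Fin 2) (Fin 2) ℂ}
    {F F' : ZMod 2 × ZMod 2 → ZMod 2 × ZMod 2} (hU : Intertwines U F) (hV : Intertwines V F') :
    Intertwines (U * V) (F ∘ F') := by
  intro p
  obtain ⟨c, hc, h⟩ := hU (F' p)
  obtain ⟨d, hd, h'⟩ := hV p
  refine ⟨c * d, mul_ne_zero hc hd, ?_⟩
  rw [Function.comp_apply, ← mul_assoc, h, smul_mul_assoc, mul_assoc, h', mul_smul_comm, smul_smul,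
    mul_assoc]

theorem Intertwines.inv {U V : Matrix (Fin 2) (Fin 2) ℂ} (hUV : U * V = 1) (hVU : V * U = 1)
    {F F' : ZMod 2 × ZMod 2 → ZMod 2 × ZMod 2} (hF : ∀ p, F (F' p) = p) (hU : Intertwines U F) :
    Intertwines V F' := by
  intro p
  obtain ⟨c, hc, h⟩ := hU (F' p)
  rw [hF] at h
  refine ⟨c⁻¹, inv_ne_zero hc, ?_⟩
  have h' := congrArg (fun M => V * M * V) h
  simp only [mul_assoc, hUV, mul_one, mul_smul_comm, smul_mul_assoc] at h'
  rw [← mul_assoc V U, hVU, one_mul] at h'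
  rw [h', smul_smul, inv_mul_cancel₀ hc, one_smul]

theorem Intertwines.isPauliEigenvector {n : ℕ} {U : Fin n → Matrix (Fin 2) (Fin 2) ℂ}
    {F : Fin n → ZMod 2 × ZMod 2 → ZMod 2 × ZMod 2} (hU : ∀ i, Intertwines (U i) (F i))
    {ψ : QState n} {r s : Fin n → ZMod 2} (h : IsPauliEigenvector ψ r s) :
    IsPauliEigenvector (tensorOp U *ᵥ ψ) (fun i => (F i (r i, s i)).1)
      fun i => (F i (r i, s i)).2 := by
  obtain ⟨c, hc⟩ := h
  choose d _ hd using fun i => hU i (r i, s i)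
  refine ⟨(∏ i, d i) * c, ?_⟩
  rw [mulVec_mulVec, tensorOp_mul]
  simp only [hd]
  rw [tensorOp_smul, ← tensorOp_mul, smul_mulVec, ← mulVec_mulVec, hc, mulVec_smul, smul_smul]

/-- The shear `(r, s) ↦ (r, s + α r)`, which describes the action of the `α`-th power of the phase
gate. -/
def shear (α : ZMod 2) (p : ZMod 2 × ZMod 2) : ZMod 2 × ZMod 2 := (p.1, p.2 + α * p.1)

/-- The normal form of an element of `GL₂(𝔽₂)`: a shear, or two shears with an exchange of the
coordinates in between. -/
def localMap (swap : Bool) (α β : ZMod 2) (p : ZMod 2 × ZMod 2) : ZMod 2 × ZMod 2 :=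
  shear α (if swap then (shear β p).swap else shear β p)

theorem intertwines_hadamard : Intertwines (hadamard : Matrix (Fin 2) (Fin 2) ℂ) Prod.swap := by
  rintro ⟨r, s⟩
  refine ⟨sgn (r * s), sgn_ne_zero _, ?_⟩
  simp only [Prod.swap, hadamard, smul_mul_assoc, mul_smul_comm]
  rw [smul_comm]
  congr 1
  rcases zmod_two_cases r with rfl | rfl <;> rcases zmod_two_cases s with rfl | rfl <;>
    ext i j <;> fin_cases i <;> fin_cases j <;>
    simp [mul_apply, pauliOne, vecHead, vecTail, Fin.sum_univ_two,
      show (1 + 1 : ZMod 2) = 0 from rfl]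

theorem intertwines_phaseGate : Intertwines (phaseGate : Matrix (Fin 2) (Fin 2) ℂ) (shear 1) := by
  rintro ⟨r, s⟩
  refine ⟨if r = 0 then 1 else Complex.I, ?_, ?_⟩
  · split_ifs <;> simp
  · rcases zmod_two_cases r with rfl | rfl <;> rcases zmod_two_cases s with rfl | rfl <;>
      ext i j <;> fin_cases i <;> fin_cases j <;>
      simp [mul_apply, pauliOne, vecHead, vecTail, Fin.sum_univ_two, phaseGate, shear,
        show (1 + 1 : ZMod 2) = 0 from rfl]

theorem shear_zero : shear 0 = id := by
  funext p
  simp [shear]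

theorem exists_localMap_comp (w₁ w₂ : Bool) (α₁ β₁ α₂ β₂ : ZMod 2) :
    ∃ w α β, localMap w₁ α₁ β₁ ∘ localMap w₂ α₂ β₂ = localMap w α β := by
  have h : ∀ (w₁ w₂ : Bool) (α₁ β₁ α₂ β₂ : ZMod 2), ∃ w α β, ∀ p,
      localMap w₁ α₁ β₁ (localMap w₂ α₂ β₂ p) = localMap w α β p := by
    decide
  obtain ⟨w, α, β, hp⟩ := h w₁ w₂ α₁ β₁ α₂ β₂
  exact ⟨w, α, β, funext hp⟩

theorem exists_localMap_inv (w : Bool) (α β : ZMod 2) :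
    ∃ w' α' β', ∀ p, localMap w α β (localMap w' α' β' p) = p := by
  revert w α β
  decide

/-- Every one-qubit Clifford unitary permutes the Pauli operators, up to phases, by an element of
`GL₂(𝔽₂)`. -/
theorem exists_intertwines_of_mem {U : Matrix.unitaryGroup (Fin 2) ℂ} (hU : U ∈ cliffordOne) :
    ∃ w α β, Intertwines (U : Matrix (Fin 2) (Fin 2) ℂ) (localMap w α β) := by
  induction hU using Subgroup.closure_induction with
  | mem U hU =>
    rcases hU with rfl | rfl
    · refine ⟨true, 0, 0, ?_⟩
      have h : localMap true 0 0 = Prod.swap := by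
        funext p
        simp [localMap, shear_zero]
      exact h ▸ intertwines_hadamard
    · refine ⟨false, 1, 0, ?_⟩
      have h : localMap false 1 0 = shear 1 := by
        funext p
        simp [localMap, shear_zero]
      exact h ▸ intertwines_phaseGate
  | one =>
    refine ⟨false, 0, 0, ?_⟩
    have h : localMap false 0 0 = id := by
      funext p
      simp [localMap, shear_zero]
    exact h ▸ Intertwines.one
  | mul U V _ _ hU hV =>
    obtain ⟨w₁, α₁, β₁, h₁⟩ := hU
    obtain ⟨w₂, α₂, β₂, h₂⟩ := hV
    obtain ⟨w, α, β, h⟩ := exists_localMap_comp w₁ w₂ α₁ β₁ α₂ β₂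
    exact ⟨w, α, β, h ▸ h₁.mul h₂⟩
  | inv U _ hU =>
    obtain ⟨w, α, β, h⟩ := hU
    obtain ⟨w', α', β', h'⟩ := exists_localMap_inv w α β
    exact ⟨w', α', β', h.inv (congrArg Subtype.val (mul_inv_cancel U))
      (congrArg Subtype.val (inv_mul_cancel U)) h'⟩

theorem hadamard_mem : hadamard ∈ cliffordOne := Subgroup.subset_closure (by simp)

theorem phaseGate_mem : phaseGate ∈ cliffordOne := Subgroup.subset_closure (by simp)

/-- Every element of `GL₂(𝔽₂)` comes from a one-qubit Clifford unitary. -/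
theorem exists_mem_intertwines (w : Bool) (α β : ZMod 2) :
    ∃ U ∈ cliffordOne, Intertwines (U : Matrix (Fin 2) (Fin 2) ℂ) (localMap w α β) := by
  have hshear (α : ZMod 2) :
      ∃ U ∈ cliffordOne, Intertwines (U : Matrix (Fin 2) (Fin 2) ℂ) (shear α) := by
    rcases zmod_two_cases α with rfl | rfl
    · exact ⟨1, one_mem _, shear_zero ▸ Intertwines.one⟩
    · exact ⟨phaseGate, phaseGate_mem, intertwines_phaseGate⟩
  obtain ⟨U, hU, hU'⟩ := hshear α
  obtain ⟨V, hV, hV'⟩ := hshear β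
  cases w
  · exact ⟨U * V, mul_mem hU hV, hU'.mul hV'⟩
  · exact ⟨U * (hadamard * V), mul_mem hU (mul_mem hadamard_mem hV),
      hU'.mul (intertwines_hadamard.mul hV')⟩

theorem exists_mem_pauliOne (t : ZMod 2) :
    ∃ U ∈ cliffordOne, (U : Matrix (Fin 2) (Fin 2) ℂ) = pauliOne 0 t := by
  rcases zmod_two_cases t with rfl | rfl
  · refine ⟨1, one_mem _, ?_⟩
    ext i j
    fin_cases i <;> fin_cases j <;> simp [pauliOne]
  · refine ⟨phaseGate * phaseGate, mul_mem phaseGate_mem phaseGate_mem, ?_⟩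
    ext i j
    fin_cases i <;> fin_cases j <;>
      simp [pauliOne, phaseGate]

/-! ### States with the stabilizers of a graph state -/

/-- A sign character of `𝔽₂ⁿ` is `x ↦ (-1)^(t ⬝ x)` for some `t`. -/
theorem exists_eq_sgn_dotProduct {n : ℕ} (f : (Fin n → ZMod 2) → ℂ) (h₀ : f 0 = 1)
    (hadd : ∀ x y, f (x + y) = f x * f y) : ∃ t : Fin n → ZMod 2, ∀ x, f x = sgn (t ⬝ᵥ x) := by
  have hval (x) : f x = 1 ∨ f x = -1 := by
    rw [← mul_self_eq_one_iff, ← hadd]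
    convert h₀
    exact funext fun i => CharTwo.add_self_eq_zero _
  choose t ht using fun i : Fin n => show ∃ t : ZMod 2, f (Pi.single i 1) = sgn t by
    rcases hval (Pi.single i 1) with h | h
    · exact ⟨0, by simp [h]⟩
    · exact ⟨1, by simp [h]⟩
  refine ⟨t, fun x => ?_⟩
  have hsum (s : Finset (Fin n)) : f (∑ i ∈ s, Pi.single i (x i)) = ∏ i ∈ s, sgn (t i * x i) := by
    induction s using Finset.induction_on with
    | empty => simpa using h₀
    | insert a s ha ih =>
      rw [Finset.sum_insert ha, Finset.prod_insert ha, hadd, ih]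
      congr 1
      rcases zmod_two_cases (x a) with h | h
      · simp [h, h₀]
      · simp [h, ht]
  rw [dotProduct, sgn_sum, ← hsum, Finset.univ_sum_single]

/-- A nonzero state stabilized up to phases by all `Z^{A r} X^r` is, up to a scalar and Pauli `Z`
operators, the graph state with adjacency matrix `A`. -/
theorem exists_eq_smul_graphState {n : ℕ} (G : SimpleGraph (Fin n)) [DecidableRel G.Adj]
    {φ : QState n} (hφ : φ ≠ 0)
    (h : ∀ r, IsPauliEigenvector φ r (G.adjMatrix (ZMod 2) *ᵥ r)) :
    ∃ (c : ℂ) (t : Fin n → ZMod 2),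
      φ = c • ((tensorOp fun i => pauliOne 0 (t i)) *ᵥ graphState G) := by
  choose χ hχ using fun r => isPauliEigenvector_iff.mp (h r)
  have hχ₀ (r : Fin n → ZMod 2) : amplitude φ r = χ r * amplitude φ 0 := by
    have := hχ r 0
    rwa [dotProduct_zero, sgn_zero, one_mul, zero_add] at this
  have h₀ : amplitude φ 0 ≠ 0 := by
    intro h₀
    refine hφ (amplitude_ext fun x => ?_)
    rw [hχ₀, h₀, mul_zero]
    rfl
  have hadd (x r : Fin n → ZMod 2) : amplitude φ (x + r) * amplitude φ 0 =
      sgn (x ⬝ᵥ G.adjMatrix (ZMod 2) *ᵥ r) * (amplitude φ x * amplitude φ r) := by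
    have h₁ := hχ r x
    rw [dotProduct_comm] at h₁
    have h₂ : amplitude φ (x + r) = sgn (x ⬝ᵥ G.adjMatrix (ZMod 2) *ᵥ r) *
        (χ r * amplitude φ x) := by
      rw [← h₁, ← mul_assoc, sgn_mul_self, one_mul]
    rw [h₂, hχ₀ r]
    ring
  obtain ⟨t, ht⟩ := exists_eq_sgn_dotProduct
    (fun x => amplitude φ x / (amplitude φ 0 * graphSign G x))
    (by rw [graphSign_zero, mul_one, div_self h₀]) (fun x r => by
      have hx := graphSign_ne_zero G x
      have hr := graphSign_ne_zero G r
      have hs := sgn_ne_zero (x ⬝ᵥ G.adjMatrix (ZMod 2) *ᵥ r)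
      rw [graphSign_add, div_mul_div_comm, div_eq_div_iff (by positivity) (by positivity)]
      linear_combination (amplitude φ 0 * graphSign G x * graphSign G r) * hadd x r)
  refine ⟨amplitude φ 0 / (1 / (Real.sqrt 2 : ℂ)) ^ n, t, amplitude_ext fun x => ?_⟩
  have hx := ht x
  rw [div_eq_iff (mul_ne_zero h₀ (graphSign_ne_zero G x))] at hx
  have hz := amplitude_tensorOp_pauliOne (graphState G) 0 t x
  simp only [Pi.zero_apply] at hz
  rw [hx, amplitude_smul, hz, add_zero, amplitude_graphState]
  have := inv_sqrt_two_pow_ne_zero n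
  field_simp

/-! ### Norms -/

theorem sum_norm_sq_mulVec {m : Type*} [Fintype m] [DecidableEq m] {U : Matrix m m ℂ}
    (hU : Uᴴ * U = 1) (ψ : m → ℂ) : ∑ y, ‖(U *ᵥ ψ) y‖ ^ 2 = ∑ y, ‖ψ y‖ ^ 2 := by
  have h (φ : m → ℂ) : ((∑ y, ‖φ y‖ ^ 2 : ℝ) : ℂ) = star φ ⬝ᵥ φ := by
    simp only [dotProduct, Pi.star_apply, Complex.ofReal_sum, Complex.ofReal_pow]
    exact Finset.sum_congr rfl fun y _ => (Complex.conj_mul' (φ y)).symm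
  have : ((∑ y, ‖(U *ᵥ ψ) y‖ ^ 2 : ℝ) : ℂ) = ((∑ y, ‖ψ y‖ ^ 2 : ℝ) : ℂ) := by
    rw [h, h, star_mulVec, ← dotProduct_mulVec, mulVec_mulVec, hU, one_mulVec]
  exact_mod_cast this

theorem sum_norm_sq_tensorOp {n : ℕ} (U : Fin n → Matrix.unitaryGroup (Fin 2) ℂ) (ψ : QState n) :
    ∑ y, ‖(tensorOp (fun i => (U i : Matrix (Fin 2) (Fin 2) ℂ)) *ᵥ ψ) y‖ ^ 2 =
      ∑ y, ‖ψ y‖ ^ 2 := by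
  apply sum_norm_sq_mulVec
  rw [tensorOp_conjTranspose, tensorOp_mul, ← tensorOp_one]
  congr 1
  funext i
  exact Matrix.mem_unitaryGroup_iff'.mp (U i).2

theorem sum_norm_sq_graphState {n : ℕ} (G : SimpleGraph (Fin n)) [DecidableRel G.Adj] :
    ∑ y, ‖graphState G y‖ ^ 2 = 1 := by
  have h (y : Fin n → Fin 2) : ‖graphState G y‖ ^ 2 = (1 / 2) ^ n := by
    have hy := amplitude_graphState G fun i => digit.symm (y i)
    simp only [amplitude, Equiv.apply_symm_apply] at hy
    rw [hy, norm_mul, norm_graphSign, one_mul, norm_pow, ← pow_mul, mul_comm n 2, pow_mul]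
    congr 1
    rw [norm_div, norm_one, Complex.norm_real, Real.norm_of_nonneg (Real.sqrt_nonneg 2), div_pow,
      Real.sq_sqrt (by norm_num), one_pow]
  simp [h]

/-! ### Local Clifford equivalence as a pivot transform -/

/-- Graph states are locally Clifford equivalent exactly when, for suitable diagonals, their
adjacency matrices are related by a principal pivot transform: `K` collects the qubits on which the
Clifford unitary exchanges `X` and `Z` between two shears, and the shears are the diagonals. -/
theorem lcEquivalent_graphState_iff {n : ℕ} (G H : SimpleGraph (Fin n)) [DecidableRel G.Adj]
    [DecidableRel H.Adj] :
    LCEquivalent (graphState G) (graphState H) ↔ ∃ (K : Finset (Fin n)) (u v : Fin n → ZMod 2),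
      IsPivotTransform K (G.adjMatrix (ZMod 2) + diagonal u)
        (H.adjMatrix (ZMod 2) + diagonal v) := by
  have hdiag (A : Matrix (Fin n) (Fin n) (ZMod 2)) (d r : Fin n → ZMod 2) (i : Fin n) :
      ((A + diagonal d) *ᵥ r) i = (A *ᵥ r) i + d i * r i := by
    rw [add_mulVec, Pi.add_apply, mulVec_diagonal]
  have two (x y : ZMod 2) : x + y + y = x := by
    rw [add_assoc, CharTwo.add_self_eq_zero, add_zero]
  constructor
  · rintro ⟨U, hU, c, hc, hψ⟩
    choose w α β hF using fun i => exists_intertwines_of_mem (hU i)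
    refine ⟨Finset.univ.filter fun i => w i = true, α, β, fun r => ?_⟩
    have h₁ := Intertwines.isPauliEigenvector hF
      ((isPauliEigenvector_graphState H r _).mpr rfl)
    have h₂ : IsPauliEigenvector (graphState G)
        (fun i => (localMap (w i) (α i) (β i) (r i, (H.adjMatrix (ZMod 2) *ᵥ r) i)).1)
        fun i => (localMap (w i) (α i) (β i) (r i, (H.adjMatrix (ZMod 2) *ᵥ r) i)).2 := by
      obtain ⟨d, hd⟩ := h₁
      exact ⟨d, by rw [hψ, mulVec_smul, hd, smul_comm]⟩
    rw [isPauliEigenvector_graphState] at h₂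
    have h₃ : (fun i => (localMap (w i) (α i) (β i) (r i, (H.adjMatrix (ZMod 2) *ᵥ r) i)).1) =
        (Finset.univ.filter fun i => w i = true).piecewise
          ((H.adjMatrix (ZMod 2) + diagonal β) *ᵥ r) r := by
      ext i
      cases hw : w i <;> simp [localMap, shear, Finset.piecewise, hw, hdiag]
    rw [h₃] at h₂
    ext i
    rw [hdiag, ← congrFun h₂ i]
    cases hw : w i <;> simp [localMap, shear, Finset.piecewise, hw, hdiag, two]
  · rintro ⟨K, u, v, hK⟩
    choose U hU hF using fun i => exists_mem_intertwines (decide (i ∈ K)) (u i) (v i)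
    set φ : QState n := tensorOp (fun i => (U i : Matrix (Fin 2) (Fin 2) ℂ)) *ᵥ graphState H
      with hφ
    have hnorm : ∑ y, ‖φ y‖ ^ 2 = 1 := by
      rw [hφ, sum_norm_sq_tensorOp, sum_norm_sq_graphState]
    have hφ₀ : φ ≠ 0 := by
      intro h
      simp [h] at hnorm
    have hstab (r) : IsPauliEigenvector φ r (G.adjMatrix (ZMod 2) *ᵥ r) := by
      obtain ⟨s, rfl⟩ := hK.surjective r
      convert Intertwines.isPauliEigenvector hF
        ((isPauliEigenvector_graphState H s _).mpr rfl) using 1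
      · ext i
        by_cases hi : i ∈ K <;> simp [localMap, shear, hi, hdiag]
      · ext i
        have hi' := congrFun (hK s) i
        rw [hdiag, ← CharTwo.sub_eq_add, sub_eq_iff_eq_add] at hi'
        rw [hi']
        by_cases hi : i ∈ K <;> simp [localMap, shear, hi, hdiag]
    obtain ⟨c, t, hct⟩ := exists_eq_smul_graphState G hφ₀ hstab
    choose V hV hVt using fun i => exists_mem_pauliOne (t i)
    simp only [← hVt] at hct
    have hc : ‖c‖ = 1 := by
      have h := hnorm
      simp only [hct, Pi.smul_apply, smul_eq_mul, norm_mul, mul_pow, ← Finset.mul_sum] at h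
      rw [sum_norm_sq_tensorOp, sum_norm_sq_graphState, mul_one] at h
      exact (pow_eq_one_iff_of_nonneg (norm_nonneg c) two_ne_zero).mp h
    have hc₀ : c ≠ 0 := by
      rw [← norm_ne_zero_iff, hc]
      exact one_ne_zero
    refine ⟨fun i => (V i)⁻¹ * U i, fun i => mul_mem (inv_mem (hV i)) (hU i), c⁻¹,
      by rw [norm_inv, hc, inv_one], ?_⟩
    have hVU : (tensorOp fun i => (((V i)⁻¹ * U i : Matrix.unitaryGroup (Fin 2) ℂ) :
        Matrix (Fin 2) (Fin 2) ℂ)) =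
        tensorOp (fun i => (((V i)⁻¹ : Matrix.unitaryGroup (Fin 2) ℂ) :
          Matrix (Fin 2) (Fin 2) ℂ)) *
          tensorOp fun i => (U i : Matrix (Fin 2) (Fin 2) ℂ) := by
      rw [tensorOp_mul]
      rfl
    have hVV : tensorOp (fun i => (((V i)⁻¹ : Matrix.unitaryGroup (Fin 2) ℂ) :
          Matrix (Fin 2) (Fin 2) ℂ)) *
          tensorOp (fun i => (V i : Matrix (Fin 2) (Fin 2) ℂ)) = 1 := by
      rw [tensorOp_mul, ← tensorOp_one]
      congr 1
      funext i
      exact congrArg Subtype.val (inv_mul_cancel (V i))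
    rw [hVU, ← mulVec_mulVec, ← hφ, hct, mulVec_smul, mulVec_mulVec, hVV, one_mulVec, smul_smul,
      inv_mul_cancel₀ hc₀, one_smul]

/-! ### Admissible inputs -/

theorem HasLDL.leadingBlock {n k : ℕ} (hk : k ≤ n) {A : Matrix (Fin n) (Fin n) (ZMod 2)}
    (h : HasLDL A) : HasLDL (leadingBlock A k hk) := by
  obtain ⟨m, rfl⟩ := Nat.exists_eq_add_of_le hk
  rw [hasLDL_iff] at h ⊢
  obtain ⟨L, D, hLD, hdiag, hlower, ⟨β, hβ, hβ₃, hβ₀, hβ₂⟩, hnorm⟩ := h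
  have hL₀ (a : Fin k) (c : Fin m) : L (Fin.castLE hk a) (Fin.natAdd k c) = 0 :=
    hlower _ _ (Fin.lt_def.mpr (by have := a.2; simp; omega))
  have hcast (a : Fin k) : Fin.castAdd m a = Fin.castLE hk a := rfl
  refine ⟨LCGraph.leadingBlock L k hk, LCGraph.leadingBlock D k hk, ?_, fun i => hdiag _,
    fun i j hij => hlower _ _ hij, ⟨fun i => β (Fin.castLE hk i), fun i j hij => hβ hij,
      fun i j l hij hjl => hβ₃ _ (Fin.castLE hk j) _ hij hjl, fun i j hij => hβ₀ _ _ hij,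
      fun i j hij => hβ₂ _ _ hij⟩, fun i j hij => hnorm _ _ hij⟩
  ext a b
  rw [hLD]
  simp [LCGraph.leadingBlock, mul_apply, Fin.sum_univ_add, hL₀, hcast]

theorem IsPivotTransform.rank_leadingBlock {n k : ℕ} (hk : k ≤ n)
    {A B : Matrix (Fin n) (Fin n) (ZMod 2)}
    (h : IsPivotTransform (Finset.univ.filter fun x : Fin n => (x : ℕ) < k) A B) :
    (leadingBlock B k hk).rank = k := by
  obtain ⟨m, rfl⟩ := Nat.exists_eq_add_of_le hk
  have hcast (a : Fin k) : Fin.castAdd m a = Fin.castLE hk a := rfl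
  rw [rank_of_isUnit, Fintype.card_fin]
  rw [← mulVec_injective_iff_isUnit]
  refine (injective_iff_map_eq_zero (leadingBlock B k hk).mulVecLin).mpr ?_
  intro r hr
  have h₀ := h.nonsingular (Fin.append r 0) (fun x hx => by
    induction x using Fin.addCases with
    | left x => simp at hx
    | right x => simp) fun x hx => by
    induction x using Fin.addCases with
    | left x =>
      refine Eq.trans ?_ (congrFun hr x)
      simp [mulVec, dotProduct, Fin.sum_univ_add, leadingBlock, hcast]
    | right x => simp at hx
  ext x
  simpa using congrFun h₀ (Fin.castAdd m x)

theorem IsJ.leadingBlock {n k : ℕ} (hk : k ≤ n) {A : Matrix (Fin n) (Fin n) (ZMod 4)} (h : IsJ A) :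
    IsJ (leadingBlock A k hk) := by
  refine ⟨?_, ?_⟩
  · ext a b
    have := congrFun (congrFun h.1 (Fin.castLE hk a)) (Fin.castLE hk b)
    simpa [Omega12, omega1, LCGraph.leadingBlock, diagonal_apply, Fin.ext_iff] using this
  · ext a b
    exact congrFun (congrFun h.2 (Fin.castLE hk a)) (Fin.castLE hk b)

theorem isJ_adjMatrix_add_diagonal {n : ℕ} (G : SimpleGraph (Fin n)) [DecidableRel G.Adj]
    (π : Equiv.Perm (Fin n)) (v : Fin n → ZMod 2) :
    IsJ ((G.adjMatrix (ZMod 4)).submatrix π π + diagonal fun i => lift (v i)) := by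
  have h₁ (x : ZMod 2) : lift x + 2 * lift (bit 2 (lift x)) = lift x := by
    revert x
    decide
  have h₂ : lift (bit 1 1) = 1 := by decide
  have h₃ : lift (bit 1 0) = 0 := by decide
  refine ⟨?_, ?_⟩
  · ext i j
    by_cases hij : i = j
    · subst hij
      simp [Omega12, omega1, h₁]
    · simp only [Omega12, omega1, Matrix.add_apply, map_apply, diagonal_apply_ne _ hij, add_zero,
        submatrix_apply, SimpleGraph.adjMatrix_apply]
      split_ifs
      · exact h₂
      · exact h₃
  · rw [transpose_add, diagonal_transpose, transpose_submatrix, SimpleGraph.transpose_adjMatrix]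

theorem omega1_adjMatrix_add_diagonal {n : ℕ} (G : SimpleGraph (Fin n)) [DecidableRel G.Adj]
    (π : Equiv.Perm (Fin n)) (v : Fin n → ZMod 2) :
    omega1 ((G.adjMatrix (ZMod 4)).submatrix π π + diagonal fun i => lift (v i)) =
      (G.adjMatrix (ZMod 2)).submatrix π π + diagonal v := by
  have h₂ : bit 1 1 = 1 := by decide
  have h₃ : bit 1 0 = 0 := by decide
  ext i j
  by_cases hij : i = j
  · subst hij
    simp [omega1]
  · simp only [omega1, Matrix.add_apply, map_apply, diagonal_apply_ne _ hij, add_zero,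
      submatrix_apply, SimpleGraph.adjMatrix_apply]
    split_ifs
    · exact h₂
    · exact h₃

theorem add_diagonal_submatrix {n : ℕ} (A : Matrix (Fin n) (Fin n) (ZMod 2))
    (π : Equiv.Perm (Fin n)) (u : Fin n → ZMod 2) :
    (A + diagonal u).submatrix π π = A.submatrix π π + diagonal (u ∘ π) := by
  rw [submatrix_add, Pi.add_apply, Pi.add_apply, submatrix_diagonal_equiv]

end LCGraph

open LCGraph in
theorem theorem7p1 (n : ℕ) (G H : SimpleGraph (Fin n)) [DecidableRel G.Adj] [DecidableRel H.Adj] :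
    LCGraph.LCEquivalent (LCGraph.graphState G) (LCGraph.graphState H) ↔
      ∃ (π : Equiv.Perm (Fin n)) (u v : Fin n → ZMod 2) (k : ℕ) (hk : k ≤ n),
        LCGraph.GammaAdmissible k hk
          ((H.adjMatrix (ZMod 4)).submatrix π π +
            Matrix.diagonal fun i => LCGraph.lift (v i)) ∧
        (G.adjMatrix (ZMod 2)).submatrix π π + Matrix.diagonal u =
          LCGraph.omega1 (LCGraph.Gamma k hk
            ((H.adjMatrix (ZMod 4)).submatrix π π +
              Matrix.diagonal fun i => LCGraph.lift (v i))) := by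
  rw [lcEquivalent_graphState_iff]
  constructor
  · rintro ⟨K, u, v, hK⟩
    have hsymm : (H.adjMatrix (ZMod 2) + Matrix.diagonal v).IsSymm :=
      (H.isSymm_adjMatrix).add (Matrix.isSymm_diagonal v)
    obtain ⟨π, hπ, hLDL⟩ := exists_hasLDL_submatrix n (Fin n) (Fintype.card_fin n) K _ hsymm
      hK.nonsingular
    have hk : K.card ≤ n := by simpa using Finset.card_le_univ K
    have hK' := hK.submatrix π (K' := Finset.univ.filter fun x : Fin n => (x : ℕ) < K.card)
      (fun x => by simp [hπ])
    rw [add_diagonal_submatrix] at hLDL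
    rw [add_diagonal_submatrix, add_diagonal_submatrix] at hK'
    have hM := omega1_adjMatrix_add_diagonal H π (v ∘ π)
    have hJ := isJ_adjMatrix_add_diagonal H π (v ∘ π)
    refine ⟨π, u ∘ π, v ∘ π, K.card, hk, ?_⟩
    set M := (H.adjMatrix (ZMod 4)).submatrix π π + Matrix.diagonal fun i => lift ((v ∘ π) i)
      with hM_def
    rw [← hM] at hLDL hK'
    have hadm : GammaAdmissible K.card hk M :=
      ⟨⟨hJ, hLDL⟩, ⟨hJ.leadingBlock hk, hLDL.leadingBlock hk⟩, hK'.rank_leadingBlock hk⟩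
    exact ⟨hadm, hK'.unique hadm.isPivotTransform⟩
  · rintro ⟨π, u, v, k, hk, hadm, heq⟩
    have h := hadm.isPivotTransform
    rw [← heq, omega1_adjMatrix_add_diagonal] at h
    have h' := h.submatrix π.symm
      (K' := Finset.univ.filter fun x : Fin n => (π.symm x : ℕ) < k) (fun x => by simp)
    rw [add_diagonal_submatrix, add_diagonal_submatrix, Matrix.submatrix_submatrix,
      Matrix.submatrix_submatrix, Equiv.self_comp_symm, Matrix.submatrix_id_id,
      Matrix.submatrix_id_id] at h'
    exact ⟨_, _, _, h'⟩
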